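/- Let $B^3$ be the unit ball of $\mathbb R^3$ with Lebesgue measure, $e_n(r)=\frac{\sin(n\pi r)}{\sqrt{\pi}\,r}$ ($n\ge 1$) the radial Dirichlet eigenfunctions of $\Delta_{B^3}$, $H=\sqrt{-\Delta_{B^3}}$ (so $He_n=n\pi e_n$) and $S(t)=e^{itH}$. Fix $\sigma\in(0,\frac12)$ and $p\in(4,6)$. Let $H^\sigma$ be the space of series $u=\sum_n c_ne_n$, $c_n\in\mathbb C$, with $\|u\|_{H^\sigma}^2=\sum_n (n\pi)^{2\sigma}|c_n|^2<\infty$. Let $\chi\in C_c^\infty(\mathbb R;\mathbb R)$ be supported in $[-1,1]$ with $\chi=1$ on $[-\frac12,\frac12]$, and put $S_N\sum_n c_ne_n=\sum_n\chi(n^2/N^2)c_ne_n$ and $E_N=\mathrm{span}(e_1,\dots,e_N)$. For $u_0\in H^\sigma$ let $\psi_N(t)u_0=S(t)u_0+v_N(t)$, where $v_N:\mathbb R\to E_N$ is the global solution of $$i\partial_tv+Hv+S_NH^{-1}\big((S_N\Re(S(t)u_0+v))^3\big)=0,\qquad v(0)=0.$$ Let $(g_n)_{n\ge1}$ be independent complex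 Gaussian variables on a probability space $(\Omega,P)$, whose real and imaginary parts are independent, centred, of common variance $\mathsf v>0$. Let $\mu$ be the law on $H^\sigma$ of $\sum_{n\ge1}\frac{g_n}{n\pi}e_n$, and let $d\rho(u)=e^{-\frac14\int_{B^3}|\Re u|^4}\,d\mu(u)$. For $D\ge0$ let $$A(D)=\{u_0\in H^\sigma:\ \|S(t)u_0\|_{L^p_{t,x}([0,2]\times B^3)}\le D\ \text{ and }\ \|u_0\|_{H^\sigma}\le D\}.$$ Let $c,c_1,\gamma_1>0$ be any constants, $\gamma=1-\frac4p$, $\tau(D)=c(1+D)^{-\gamma}$ and $\tau_1(D)=\min(c_1(1+D)^{-\gamma_1},\tau(D))$. For $i,j\in\mathbb N=\{0,1,2,\dots\}$ put $$D_{i,j}=(i+j^{1/\gamma_1})^{1/2},\qquad T_{i,j}=\sum_{l=1}^j\tau_1(D_{i,l}),$$ $$\Pi_{N,i}=\{u_0\in H^\sigma:\ \psi_N(T_{i,j})u_0\in A(D_{i,j+1})\text{ and }\psi_N(-T_{i,j})u_0\in A(D_{i,j+1})\text{ for all }j\in\mathbb N\},$$ $$\Pi_i=\limsup_{N\to\infty}\Pi_{N,i}=\bigcap_{M}\bigcup_{N\ge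 M}\Pi_{N,i},\qquad \Pi=\bigcup_{i\in\mathbb N}\Pi_i.$$ Then $\Pi$ has full $\rho$-measure: $\rho(H^\sigma\setminus\Pi)=0$. -/

import Mathlib

open MeasureTheory ProbabilityTheory Filter Set
open scoped ENNReal NNReal ContDiff

noncomputable section

namespace RadialWave

/-! ### Radial Dirichlet eigenfunctions on the unit ball of `ℝ³`

Modes are indexed by `n : ℕ`; the index `n` stands for the eigenfunction number `n + 1`. -/

/-- Lebesgue measure on the unit ball of `ℝ³`. -/
def ballMeasure : Measure (EuclideanSpace ℝ (Fin 3)) :=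
  volume.restrict (Metric.ball 0 1)

/-- The eigenvalue `(n + 1) π` of `H = √(-Δ)`. -/
def freq (n : ℕ) : ℝ := ((n : ℝ) + 1) * Real.pi

/-- The radial eigenfunction `sin ((n + 1) π r) / (√π r)`, with `r = ‖x‖`. -/
def eigenfun (n : ℕ) (x : EuclideanSpace ℝ (Fin 3)) : ℝ :=
  Real.sin (freq n * ‖x‖) / (Real.sqrt Real.pi * ‖x‖)

lemma freq_pos (n : ℕ) : 0 < freq n := by
  unfold freq; positivity

lemma measurable_eigenfun (n : ℕ) : Measurable (eigenfun n) := by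
  unfold eigenfun; fun_prop

lemma abs_eigenfun_le (n : ℕ) (x : EuclideanSpace ℝ (Fin 3)) :
    |eigenfun n x| ≤ freq n / Real.sqrt Real.pi := by
  unfold eigenfun
  have hpi : 0 < Real.sqrt Real.pi := Real.sqrt_pos.2 Real.pi_pos
  have hf := freq_pos n
  rcases eq_or_ne x 0 with rfl | hx
  · simp; positivity
  · have hx' : 0 < ‖x‖ := norm_pos_iff.2 hx
    rw [abs_div, abs_of_pos (mul_pos hpi hx'), div_le_div_iff₀ (mul_pos hpi hx') hpi]
    have h1 : |Real.sin (freq n * ‖x‖)| ≤ freq n * ‖x‖ :=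
      (Real.abs_sin_le_abs).trans (le_of_eq (abs_of_pos (mul_pos hf hx')))
    nlinarith

instance : IsFiniteMeasure ballMeasure := by
  unfold ballMeasure
  exact ⟨by simp⟩

lemma memLp_eigenfun (n : ℕ) :
    MemLp (fun x => (eigenfun n x : ℂ)) 2 ballMeasure := by
  refine MemLp.of_bound (C := freq n / Real.sqrt Real.pi) ?_ ?_
  · exact (Complex.measurable_ofReal.comp (measurable_eigenfun n)).aestronglyMeasurable
  · exact Eventually.of_forall fun x => by
      simpa using abs_eigenfun_le n x

/-- The eigenfunction as an element of the complex space `L²(B³)`. -/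
def eigenL2 (n : ℕ) : Lp ℂ 2 ballMeasure := (memLp_eigenfun n).toLp _

/-! ### The radial Sobolev space `H^σ` -/

/-- The coefficient sequences `(c_n)` with `∑ (n π)^{2σ} |c_n|² < ∞`. -/
def sobolevSeq (σ : ℝ) : Submodule ℂ (ℕ → ℂ) where
  carrier := {c | Memℓp (fun n => ((freq n ^ σ : ℝ) : ℂ) * c n) 2}
  zero_mem' := by
    have : (fun n => ((freq n ^ σ : ℝ) : ℂ) * (0 : ℕ → ℂ) n) = 0 := by ext n; simp
    simp only [mem_ofPred_eq, this]
    exact zero_memℓp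
  add_mem' := by
    intro a b ha hb
    have : (fun n => ((freq n ^ σ : ℝ) : ℂ) * (a + b) n)
        = (fun n => ((freq n ^ σ : ℝ) : ℂ) * a n) + fun n => ((freq n ^ σ : ℝ) : ℂ) * b n := by
      ext n; simp [mul_add]
    simp only [mem_ofPred_eq, this] at *
    exact ha.add hb
  smul_mem' := by
    intro k a ha
    have : (fun n => ((freq n ^ σ : ℝ) : ℂ) * (k • a) n)
        = k • fun n => ((freq n ^ σ : ℝ) : ℂ) * a n := by
      ext n; simp [mul_left_comm]
    simp only [mem_ofPred_eq, this] at *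
    exact ha.const_smul k

/-- The radial Sobolev space `H^σ` of the Dirichlet Laplacian on the unit ball: the series
`∑ c_n e_n` with `∑ (n π)^{2σ} |c_n|² < ∞`, each given by its coefficients. -/
def HSob (σ : ℝ) : Type := sobolevSeq σ

namespace HSob

variable {σ : ℝ}

instance : AddCommGroup (HSob σ) := inferInstanceAs (AddCommGroup (sobolevSeq σ))
instance : Module ℂ (HSob σ) := inferInstanceAs (Module ℂ (sobolevSeq σ))

/-- The coefficient sequence of `u` in the eigenfunctions. -/
def coeff : HSob σ →ₗ[ℂ] (ℕ → ℂ) := (sobolevSeq σ).subtype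

lemma coeff_injective : Function.Injective (coeff : HSob σ → ℕ → ℂ) :=
  Subtype.val_injective

/-- The weighted sequence `((n π)^σ c_n)`, an element of `ℓ²`. -/
def weighted : HSob σ →ₗ[ℂ] lp (fun _ : ℕ => ℂ) 2 where
  toFun u := ⟨fun n => ((freq n ^ σ : ℝ) : ℂ) * coeff u n, u.2⟩
  map_add' u v := by
    ext n
    change ((freq n ^ σ : ℝ) : ℂ) * coeff (u + v) n
      = ((freq n ^ σ : ℝ) : ℂ) * coeff u n + ((freq n ^ σ : ℝ) : ℂ) * coeff v n
    simp [mul_add]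
  map_smul' k u := by
    ext n; simp [mul_left_comm]

lemma weighted_injective : Function.Injective (weighted : HSob σ → lp (fun _ : ℕ => ℂ) 2) := by
  intro u v h
  apply coeff_injective
  ext n
  have h1 : ((freq n ^ σ : ℝ) : ℂ) * coeff u n = ((freq n ^ σ : ℝ) : ℂ) * coeff v n :=
    congrFun (congrArg Subtype.val h) n
  have h2 : ((freq n ^ σ : ℝ) : ℂ) ≠ 0 :=
    Complex.ofReal_ne_zero.2 (Real.rpow_pos_of_pos (freq_pos n) σ).ne'
  exact mul_left_cancel₀ h2 h1

instance : NormedAddCommGroup (HSob σ) :=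
  NormedAddCommGroup.induced (HSob σ) (lp (fun _ : ℕ => ℂ) 2) weighted weighted_injective

instance : NormedSpace ℂ (HSob σ) :=
  NormedSpace.induced ℂ (HSob σ) (lp (fun _ : ℕ => ℂ) 2) weighted

/-- The norm of `H^σ`, in explicit form. -/
lemma norm_sq_eq (u : HSob σ) :
    ‖u‖ ^ 2 = ∑' n, freq n ^ (2 * σ) * ‖coeff u n‖ ^ 2 := by
  have h : ‖u‖ = ‖weighted u‖ := rfl
  have h2 := lp.norm_rpow_eq_tsum (p := 2) (by norm_num) (weighted u)
  have h3 : ∀ n, (weighted u : ℕ → ℂ) n = ((freq n ^ σ : ℝ) : ℂ) * coeff u n := fun _ => rfl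
  simp only [ENNReal.toReal_ofNat, Real.rpow_ofNat, h3] at h2
  rw [h, h2]
  refine tsum_congr fun n => ?_
  have hf := freq_pos n
  rw [norm_mul, mul_pow, Complex.norm_real, Real.norm_of_nonneg (Real.rpow_nonneg hf.le σ),
    ← Real.rpow_natCast, ← Real.rpow_mul hf.le]
  norm_num [mul_comm]

instance : MeasurableSpace (HSob σ) := borel _
instance : BorelSpace (HSob σ) := ⟨rfl⟩

/-- For `σ ≥ 0`, the function `∑ c_n e_n` on the ball; the series converges in `L²(B³)`. -/
def toL2 (u : HSob σ) : Lp ℂ 2 ballMeasure := ∑' n, coeff u n • eigenL2 n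

/-- The linear flow `S(t) = e^{i t H}`, which multiplies `c_n` by `e^{i n π t}`. -/
def S (t : ℝ) (u : HSob σ) : HSob σ :=
  ⟨fun n => Complex.exp (Complex.I * freq n * t) * coeff u n, by
    have hu : Memℓp (fun n => ((freq n ^ σ : ℝ) : ℂ) * coeff u n) 2 := u.2
    refine memℓp_gen_iff (p := 2) (by norm_num) |>.2 ?_
    refine (memℓp_gen_iff (p := 2) (by norm_num) |>.1 hu).congr fun n => ?_
    have h1 : ‖Complex.exp (Complex.I * freq n * t)‖ = 1 := by
      rw [Complex.norm_exp]; simp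
    simp only [norm_mul, h1, one_mul]⟩

/-- The subspace `E_N` spanned by the first `N` eigenfunctions. -/
def E (N : ℕ) : Set (HSob σ) := {u | ∀ n, N ≤ n → coeff u n = 0}

end HSob

open HSob

/-! ### The truncated equation -/

/-- Admissible cut-off functions: smooth, supported in `[-1, 1]`, equal to `1` on
`[-1/2, 1/2]`. -/
structure IsCutoff (χ : ℝ → ℝ) : Prop where
  smooth : ContDiff ℝ ∞ χ
  support : tsupport χ ⊆ Icc (-1) 1
  eq_one : ∀ x ∈ Icc (-(1 / 2) : ℝ) (1 / 2), χ x = 1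

/-- The symbol `χ (n² / N²)` of `S_N` on the eigenfunction number `n + 1`. -/
def symbolSN (χ : ℝ → ℝ) (N n : ℕ) : ℝ := χ (((n : ℝ) + 1) ^ 2 / (N : ℝ) ^ 2)

/-- The function `S_N Re (∑ c_n e_n)` on the ball, for `N ≥ 1`. The sum stops at the
eigenfunction number `N` because the symbol of `S_N` vanishes beyond it. -/
def truncRe (χ : ℝ → ℝ) (N : ℕ) (c : ℕ → ℂ) (x : EuclideanSpace ℝ (Fin 3)) : ℝ :=
  ∑ n ∈ Finset.range N, symbolSN χ N n * (c n).re * eigenfun n x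

/-- The coefficient of a real function `h` on the ball along the eigenfunction `n`. -/
def radialCoeff (n : ℕ) (h : EuclideanSpace ℝ (Fin 3) → ℝ) : ℝ :=
  (∫ x, h x * eigenfun n x ∂ballMeasure) / ∫ x, eigenfun n x ^ 2 ∂ballMeasure

/-- The coefficients of `S_N H⁻¹ ((S_N Re u)³)`, where `u = ∑ c_n e_n`. -/
def truncNonlin (χ : ℝ → ℝ) (N : ℕ) (c : ℕ → ℂ) (n : ℕ) : ℝ :=
  symbolSN χ N n * (freq n)⁻¹ * radialCoeff n (fun x => truncRe χ N c x ^ 3)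

/-- `v : ℝ → E_N` is the global solution of
`i ∂ₜ v + H v + S_N H⁻¹ ((S_N Re (S(t) u₀ + v))³) = 0`, `v(0) = 0`.
The equation lives in the finite-dimensional `E_N` and is written coefficient by coefficient. -/
structure IsTruncSolution {σ : ℝ} (χ : ℝ → ℝ) (N : ℕ) (u₀ : HSob σ) (v : ℝ → HSob σ) :
    Prop where
  init : v 0 = 0
  mem : ∀ t, v t ∈ E N
  diff : ∀ n, Differentiable ℝ fun s => coeff (v s) n
  eqn : ∀ t n,
    Complex.I * deriv (fun s => coeff (v s) n) t + freq n * coeff (v t) n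
      + truncNonlin χ N (coeff (S t u₀ + v t)) n = 0

/-- `u : ℝ → H^σ` is the trajectory `t ↦ ψ_N(t) u₀` of the truncated flow, that is,
`u(t) = S(t) u₀ + v(t)` with `v` the solution above. -/
def IsTruncFlow {σ : ℝ} (χ : ℝ → ℝ) (N : ℕ) (u₀ : HSob σ) (u : ℝ → HSob σ) : Prop :=
  ∃ v, IsTruncSolution χ N u₀ v ∧ ∀ t, u t = S t u₀ + v t

/-! ### The measures `μ` and `ρ` -/

/-- The law of a complex Gaussian variable whose real and imaginary parts are independent,
centred, of variance `v`. -/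
def complexGaussian (v : ℝ≥0) : Measure ℂ :=
  ((gaussianReal 0 v).prod (gaussianReal 0 v)).map fun z => (z.1 : ℂ) + z.2 * Complex.I

open Classical in
/-- The random series `∑ g_n / (n π) e_n` in `H^σ`, set to `0` where it diverges. -/
def randomSeries {Ω : Type*} (σ : ℝ) (g : ℕ → Ω → ℂ) (w : Ω) : HSob σ :=
  if h : (fun n => g n w / freq n) ∈ sobolevSeq σ then ⟨_, h⟩ else 0

/-- The measure `μ` on `H^σ`: the law of the random series. -/
def mu {Ω : Type*} [MeasurableSpace Ω] (P : Measure Ω) (σ : ℝ) (g : ℕ → Ω → ℂ) :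
    Measure (HSob σ) :=
  P.map (randomSeries σ g)

/-- `∫_{B³} |Re u|⁴`, possibly infinite. -/
def quartic {σ : ℝ} (u : HSob σ) : ℝ≥0∞ :=
  ∫⁻ x, ENNReal.ofReal (|(toL2 u x).re| ^ 4) ∂ballMeasure

open Classical in
/-- The density `exp (-1/4 ∫_{B³} |Re u|⁴)`, which is `0` where the integral is infinite. -/
def density {σ : ℝ} (u : HSob σ) : ℝ≥0∞ :=
  if quartic u = ⊤ then 0 else ENNReal.ofReal (Real.exp (-(1 / 4) * (quartic u).toReal))

/-- The measure `dρ = exp (-1/4 ∫_{B³} |Re u|⁴) dμ`. -/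
def rho {Ω : Type*} [MeasurableSpace Ω] (P : Measure Ω) (σ : ℝ) (g : ℕ → Ω → ℂ) :
    Measure (HSob σ) :=
  (mu P σ g).withDensity density

/-! ### The set `Π` -/

/-- `‖S(t) u‖_{L^p}` over `(t, x) ∈ [0, 2] × B³`. -/
def spaceTimeNorm {σ : ℝ} (p : ℝ) (u : HSob σ) : ℝ≥0∞ :=
  (∫⁻ t in Icc (0 : ℝ) 2, ∫⁻ x, ‖toL2 (S t u) x‖ₑ ^ p ∂ballMeasure) ^ (1 / p)

/-- The set `A(D)` of data with `‖S(t) u‖_{L^p_{t,x}} ≤ D` and `‖u‖_{H^σ} ≤ D`. -/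
def setA (σ p D : ℝ) : Set (HSob σ) :=
  {u | spaceTimeNorm p u ≤ ENNReal.ofReal D ∧ ‖u‖ ≤ D}

/-- The local existence time `τ(D) = c (1 + D)^{-γ}` with `γ = 1 - 4/p`. -/
def tau (p c D : ℝ) : ℝ := c * (1 + D) ^ (-(1 - 4 / p))

/-- `τ₁(D) = min (c₁ (1 + D)^{-γ₁}, τ(D))`. -/
def tau1 (p c c₁ γ₁ D : ℝ) : ℝ := min (c₁ * (1 + D) ^ (-γ₁)) (tau p c D)

/-- `D_{i,j} = (i + j^{1/γ₁})^{1/2}`. -/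
def Dseq (γ₁ : ℝ) (i j : ℕ) : ℝ := Real.sqrt (i + (j : ℝ) ^ (1 / γ₁))

/-- `T_{i,j} = ∑_{l=1}^{j} τ₁(D_{i,l})`. -/
def Tseq (p c c₁ γ₁ : ℝ) (i j : ℕ) : ℝ :=
  ∑ l ∈ Finset.Icc 1 j, tau1 p c c₁ γ₁ (Dseq γ₁ i l)

/-- `Π_{N,i}`: the data whose truncated flow satisfies `ψ_N(± T_{i,j}) u₀ ∈ A(D_{i,j+1})` for
every `j`. -/
def PiNi (χ : ℝ → ℝ) (σ p c c₁ γ₁ : ℝ) (N i : ℕ) : Set (HSob σ) :=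
  {u₀ | ∃ u : ℝ → HSob σ, IsTruncFlow χ N u₀ u ∧
    ∀ j : ℕ, u (Tseq p c c₁ γ₁ i j) ∈ setA σ p (Dseq γ₁ i (j + 1)) ∧
      u (-Tseq p c c₁ γ₁ i j) ∈ setA σ p (Dseq γ₁ i (j + 1))}

/-- `Π_i = limsup_N Π_{N,i}`. -/
def PiI (χ : ℝ → ℝ) (σ p c c₁ γ₁ : ℝ) (i : ℕ) : Set (HSob σ) :=
  limsup (fun N => PiNi χ σ p c c₁ γ₁ N i) atTop

/-- `Π = ⋃_i Π_i`. -/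
def PiSet (χ : ℝ → ℝ) (σ p c c₁ γ₁ : ℝ) : Set (HSob σ) :=
  ⋃ i : ℕ, PiI χ σ p c c₁ γ₁ i

end RadialWave

end

noncomputable section

namespace RadialWave

/-! ### Moments of Gaussian sums -/

/-! The proof is an almost-invariance argument for a Gibbs measure, carried out for each truncation
and made uniform in `N`. It gives that the complement of `Π` is already `μ`-null; `ρ` enters only as
a measure with a density with respect to `μ`.

Free evolution. At a point `x` the Gaussian series has variance `∑ (e_n(x) / nπ)² ≤ C ‖x‖^(-2a)` for
every `a ∈ (1/2, 1]`, and `‖x‖^(-a)` lies in `L^p` of the ball when `a p < 3`. Both conditions can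
be met because `p < 6`. All moments of the space-time norm are then finite, and so are those of the
`H^σ` norm because `σ < 1/2`. Hence the data outside `A(D)` have measure `O(D^(-2m))` for every
large `m` (`IsGaussianSeq.exists_goodSeq_tail`). Multipliers of modulus at most 1 do not change the
bound, so it covers free phases and spectral projections.

Truncated evolution. Modes of index at least `N` evolve linearly. The first `N` modes solve a
Hamiltonian system `a' = F(b)`, `b' = G(a)` whose energy is the Gaussian quadratic form plus a
nonnegative quartic potential `V`. The flow is a limit of symplectic Euler steps, which are
compositions of volume-preserving shears, and it conserves the energy. So it does not increase the
Gibbs measure of open sets (`IsHamFlow.lintegral_comp_le`). On `{V ≤ K}` the Gaussian and Gibbs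
densities are comparable, so the probability of landing in a set at a given time is at most `exp (K
/ v)` times the Gaussian measure of that set (`IsGaussianSeq.measure_hamFlow_mem_le`). This bound is
the same at every time.

Conclusion. The exit bounds are summed over `j`; since `D_{i,j}² = i + j^(1/γ₁)`, a large `m` makes
the sum `O(1/i)`. With the uniform tail of `V` this yields `μ(Π_{N,i}ᶜ) ≤ C K^(-3/2) + B(K) / i` for
all `N ≥ 1` (`exists_measure_compl_PiNi_le`). The complement of a limes superior inherits a bound
uniform in `N`. Letting `i → ∞` and then `K → ∞` finishes the proof (`measure_compl_PiSet`). -/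

lemma integrable_exp_re_mul_complexGaussian (v : ℝ≥0) (z : ℂ) :
    Integrable (fun w => Real.exp (z * w).re) (complexGaussian v) := by
  unfold complexGaussian
  rw [integrable_map_measure (by fun_prop) (by fun_prop)]
  refine ((integrable_exp_mul_gaussianReal (μ := 0) (v := v) z.re).mul_prod
    (integrable_exp_mul_gaussianReal (μ := 0) (v := v) (-z.im))).congr (ae_of_all _ fun q => ?_)
  simp [← Real.exp_add, sub_eq_add_neg]

lemma integral_exp_re_mul_complexGaussian (v : ℝ≥0) (z : ℂ) :
    ∫ w, Real.exp (z * w).re ∂(complexGaussian v) = Real.exp (v * ‖z‖ ^ 2 / 2) := by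
  unfold complexGaussian
  rw [integral_map (by fun_prop) (by fun_prop)]
  have h : ∀ q : ℝ × ℝ, Real.exp (z * ((q.1 : ℂ) + q.2 * Complex.I)).re
      = Real.exp (z.re * q.1) * Real.exp (-z.im * q.2) := fun q => by
    simp [← Real.exp_add, sub_eq_add_neg]
  have key : ∀ t : ℝ, ∫ x, Real.exp (t * x) ∂(gaussianReal 0 v) = Real.exp (v * t ^ 2 / 2) :=
    fun t => by
      have := congrFun (mgf_id_gaussianReal (μ := 0) (v := v)) t
      simpa [mgf] using this
  simp_rw [h]
  rw [integral_prod_mul (fun x : ℝ => Real.exp (z.re * x)) (fun y : ℝ => Real.exp (-z.im * y)),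
    key, key, ← Real.exp_add, ← Complex.normSq_eq_norm_sq, Complex.normSq_apply]
  congr 1; ring

section

variable {Ω : Type*} [MeasurableSpace Ω] {P : Measure Ω} {v : ℝ≥0} {g : ℕ → Ω → ℂ}

/-- A sequence of independent complex Gaussian variables whose real and imaginary parts are
independent, centred, of variance `v`. -/
structure IsGaussianSeq (P : Measure Ω) (v : ℝ≥0) (g : ℕ → Ω → ℂ) : Prop where
  meas : ∀ n, Measurable (g n)
  law : ∀ n, P.map (g n) = complexGaussian v
  indep : iIndepFun g P

variable [IsProbabilityMeasure P]

lemma IsGaussianSeq.lintegral_exp_sum (hg : IsGaussianSeq P v g) (s : Finset ℕ) (z : ℕ → ℂ) :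
    ∫⁻ w, ENNReal.ofReal (Real.exp (∑ n ∈ s, z n * g n w).re) ∂P
      = ENNReal.ofReal (Real.exp (v * (∑ n ∈ s, ‖z n‖ ^ 2) / 2)) := by
  have hm := hg.meas
  have hind : iIndepFun (fun n w => (z n * g n w).re) P :=
    hg.indep.comp (fun n w => (z n * w).re) (fun n => by fun_prop)
  have hmeas : ∀ n, Measurable (fun w => (z n * g n w).re) := fun n => by fun_prop
  have hint : ∀ n, Integrable (fun w => Real.exp (1 * (z n * g n w).re)) P := fun n => by
    have := integrable_exp_re_mul_complexGaussian v (z n)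
    rw [← hg.law n, integrable_map_measure (by fun_prop) (hm n).aemeasurable] at this
    simpa [Function.comp_def] using this
  have h1 := hind.mgf_sum hmeas s (t := 1)
  have h2 := hind.integrable_exp_mul_sum hmeas (s := s) (t := 1) (fun n _ => hint n)
  have h3 : ∀ n, mgf (fun w => (z n * g n w).re) P 1 = Real.exp (v * ‖z n‖ ^ 2 / 2) := fun n => by
    rw [← integral_exp_re_mul_complexGaussian v (z n), ← hg.law n,
      integral_map (hm n).aemeasurable (by fun_prop)]
    simp [mgf]
  have h4 : ∀ w, 1 * (∑ n ∈ s, fun w => (z n * g n w).re) w = (∑ n ∈ s, z n * g n w).re :=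
    fun w => by simp
  simp only [h4] at h2
  rw [← ofReal_integral_eq_lintegral_ofReal h2 (ae_of_all _ fun _ => (Real.exp_pos _).le)]
  congr 1
  simp only [mgf, h4] at h1
  rw [h1]
  simp only [mgf] at h3
  rw [Finset.prod_congr rfl fun n _ => h3 n, ← Real.exp_sum, ← Finset.sum_div, ← Finset.mul_sum]

/-- One term of the exponential series at `|x|`, together with `exp |x| ≤ exp x + exp (-x)`. It
turns exponential moments into even moments. -/
lemma pow_le_factorial_mul_exp_add (m : ℕ) (x : ℝ) :
    x ^ (2 * m) ≤ (2 * m).factorial * (Real.exp x + Real.exp (-x)) := by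
  have h : |x| ^ (2 * m) / (2 * m).factorial ≤ Real.exp |x| :=
    Real.pow_div_factorial_le_exp _ (abs_nonneg x) _
  rw [div_le_iff₀ (by positivity), (even_two_mul m).pow_abs] at h
  refine h.trans ?_
  rw [mul_comm]
  gcongr
  rcases abs_cases x with ⟨h, -⟩ | ⟨h, -⟩ <;> rw [h] <;> linarith [Real.exp_pos x, Real.exp_pos (-x)]

/-- The constant in the moment bound for Gaussian sums. -/
def momentConst (v : ℝ≥0) (m : ℕ) : ℝ :=
  2 ^ m * (2 * ((2 * m).factorial * (2 * Real.exp (v / 2))))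

lemma momentConst_nonneg (v : ℝ≥0) (m : ℕ) : 0 ≤ momentConst v m := by
  unfold momentConst; positivity

/-- Dividing by `s` makes the coefficients at most 1 in `ℓ²`, so the exponential moments of the
rescaled sum and of its opposite are at most `exp (v / 2)`. Homogeneity restores the factor `s ^ (2
* m)`. -/
lemma IsGaussianSeq.lintegral_re_pow_le (hg : IsGaussianSeq P v g) (S : Finset ℕ) (z : ℕ → ℂ)
    (m : ℕ) {s : ℝ} (hs : 0 < s) (hz : ∑ n ∈ S, ‖z n‖ ^ 2 ≤ s ^ 2) :
    ∫⁻ w, ENNReal.ofReal ((∑ n ∈ S, z n * g n w).re ^ (2 * m)) ∂P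
      ≤ ENNReal.ofReal ((2 * m).factorial * (2 * Real.exp (v / 2)) * s ^ (2 * m)) := by
  have hm := hg.meas
  have hexp : ∀ ε : ℂ, ‖ε‖ = 1 →
      ∫⁻ w, ENNReal.ofReal (Real.exp (∑ n ∈ S, ε * (s : ℂ)⁻¹ * z n * g n w).re) ∂P
        ≤ ENNReal.ofReal (Real.exp (v / 2)) := fun ε hε => by
    rw [hg.lintegral_exp_sum S (fun n => ε * (s : ℂ)⁻¹ * z n)]
    refine ENNReal.ofReal_le_ofReal (Real.exp_le_exp.2 ?_)
    have : ∑ n ∈ S, ‖ε * (s : ℂ)⁻¹ * z n‖ ^ 2 ≤ 1 := by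
      simp only [norm_mul, hε, one_mul, mul_pow, ← Finset.mul_sum, norm_inv, Complex.norm_real,
        Real.norm_of_nonneg hs.le]
      rw [inv_pow, inv_mul_le_iff₀ (by positivity)]
      simpa using hz
    have hv : (0 : ℝ) ≤ v := v.2
    nlinarith
  have hpt : ∀ w, ENNReal.ofReal ((∑ n ∈ S, z n * g n w).re ^ (2 * m)) ≤
      ENNReal.ofReal ((2 * m).factorial * s ^ (2 * m)) *
        (ENNReal.ofReal (Real.exp (∑ n ∈ S, (1 : ℂ) * (s : ℂ)⁻¹ * z n * g n w).re) +
          ENNReal.ofReal (Real.exp (∑ n ∈ S, (-1 : ℂ) * (s : ℂ)⁻¹ * z n * g n w).re)) := fun w => by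
    rw [← ENNReal.ofReal_add (Real.exp_pos _).le (Real.exp_pos _).le,
      ← ENNReal.ofReal_mul (by positivity)]
    refine ENNReal.ofReal_le_ofReal ?_
    have h1 := pow_le_factorial_mul_exp_add m (s⁻¹ * (∑ n ∈ S, z n * g n w).re)
    have e1 : ∀ ε : ℝ, (∑ n ∈ S, (ε : ℂ) * (s : ℂ)⁻¹ * z n * g n w).re
        = ε * (s⁻¹ * (∑ n ∈ S, z n * g n w).re) := fun ε => by
      rw [← mul_assoc, ← Complex.re_ofReal_mul, Finset.mul_sum]
      push_cast
      simp only [mul_assoc]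
    have e2 := e1 1
    have e3 := e1 (-1)
    push_cast at e2 e3
    rw [e2, e3, one_mul, neg_one_mul]
    calc _ = s ^ (2 * m) * (s⁻¹ * (∑ n ∈ S, z n * g n w).re) ^ (2 * m) := by
          rw [← mul_pow, mul_inv_cancel_left₀ hs.ne']
      _ ≤ s ^ (2 * m) * _ := mul_le_mul_of_nonneg_left h1 (by positivity)
      _ = _ := by ring
  refine (lintegral_mono hpt).trans ?_
  rw [lintegral_const_mul _ (by fun_prop), lintegral_add_left (by fun_prop)]
  refine (mul_le_mul_right (add_le_add (hexp 1 (by simp)) (hexp (-1) (by simp))) _).trans ?_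
  rw [← ENNReal.ofReal_add (Real.exp_pos _).le (Real.exp_pos _).le,
      ← ENNReal.ofReal_mul (by positivity)]
  refine ENNReal.ofReal_le_ofReal (le_of_eq ?_)
  ring

lemma IsGaussianSeq.lintegral_norm_pow_le (hg : IsGaussianSeq P v g) (S : Finset ℕ) (z : ℕ → ℂ)
    (m : ℕ) {s : ℝ} (hs : 0 < s) (hz : ∑ n ∈ S, ‖z n‖ ^ 2 ≤ s ^ 2) :
    ∫⁻ w, ‖∑ n ∈ S, z n * g n w‖ₑ ^ (2 * m) ∂P
      ≤ ENNReal.ofReal (momentConst v m * s ^ (2 * m)) := by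
  have hm := hg.meas
  have h1 := hg.lintegral_re_pow_le S z m hs hz
  have h2 := hg.lintegral_re_pow_le S (fun n => -Complex.I * z n) m hs (by simpa using hz)
  have hpt : ∀ w, ‖∑ n ∈ S, z n * g n w‖ₑ ^ (2 * m) ≤
      ENNReal.ofReal (2 ^ m) * (ENNReal.ofReal ((∑ n ∈ S, z n * g n w).re ^ (2 * m)) +
        ENNReal.ofReal ((∑ n ∈ S, -Complex.I * z n * g n w).re ^ (2 * m))) := fun w => by
    rw [← ENNReal.ofReal_add ((even_two_mul m).pow_nonneg _) ((even_two_mul m).pow_nonneg _),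
      ← ENNReal.ofReal_mul (by positivity), ← ofReal_norm, ← ENNReal.ofReal_pow
      (norm_nonneg _)]
    refine ENNReal.ofReal_le_ofReal ?_
    simp only [mul_assoc, ← Finset.mul_sum]
    set y := ∑ n ∈ S, z n * g n w
    have e : (-Complex.I * y).re = y.im := by simp
    rw [e, pow_mul, ← Complex.normSq_eq_norm_sq, Complex.normSq_apply, pow_mul, pow_mul,
      ← sq, ← sq]
    refine (add_pow_le (sq_nonneg _) (sq_nonneg _) m).trans ?_
    have : (0 : ℝ) ≤ (y.re ^ 2) ^ m + (y.im ^ 2) ^ m := by positivity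
    refine mul_le_mul_of_nonneg_right ?_ this
    exact pow_le_pow_right₀ (by norm_num) (Nat.sub_le _ _)
  refine (lintegral_mono hpt).trans ?_
  rw [lintegral_const_mul _ (by fun_prop), lintegral_add_left (by fun_prop)]
  refine (mul_le_mul_right (add_le_add h1 h2) _).trans ?_
  rw [← ENNReal.ofReal_add (by positivity) (by positivity), ← ENNReal.ofReal_mul (by positivity)]
  refine ENNReal.ofReal_le_ofReal (le_of_eq ?_)
  unfold momentConst
  ring

end

/-! ### From pointwise moments to moments of `L^p` norms. -/

/-- Hölder with exponent `q / p` for the function `(f / W) ^ p` against the measure `W ^ p κ`. In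
the application `W` dominates the pointwise standard deviation of a Gaussian sum, so that `f / W`
has bounded moments and only the total mass `∫ W ^ p` matters. -/
lemma lintegral_rpow_rpow_le_of_weight {X : Type*} [MeasurableSpace X] {κ : Measure X}
    {f W : X → ℝ≥0∞} (hf : Measurable f) (hW : Measurable W) (hW0 : ∀ᵐ x ∂κ, W x ≠ 0)
    (hWt : ∀ᵐ x ∂κ, W x ≠ ⊤) {p q : ℝ} (hp : 0 < p) (hpq : p < q) :
    (∫⁻ x, f x ^ p ∂κ) ^ (q / p)
      ≤ (∫⁻ x, (f x / W x) ^ q * W x ^ p ∂κ) * (∫⁻ x, W x ^ p ∂κ) ^ (q / p - 1) := by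
  set k := q / p with hk
  have hk1 : 1 < k := by rw [hk, one_lt_div hp]; exact hpq
  have hk0 : 0 < k := by linarith
  have hconj := Real.HolderConjugate.conjExponent hk1
  set k' := Real.conjExponent k
  have hk'0 : 0 < k' := hconj.symm.pos
  have hH := ENNReal.lintegral_mul_le_Lp_mul_Lq κ hconj
    (f := fun x => (f x / W x) ^ p * W x ^ (p / k)) (g := fun x => W x ^ (p / k'))
    (by fun_prop) (by fun_prop)
  have h1 : ∫⁻ x, f x ^ p ∂κ
      = ∫⁻ x, ((fun x => (f x / W x) ^ p * W x ^ (p / k)) * fun x => W x ^ (p / k')) x ∂κ := by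
    refine lintegral_congr_ae ?_
    filter_upwards [hW0, hWt] with x h0 ht
    simp only [Pi.mul_apply]
    rw [mul_assoc, ← ENNReal.rpow_add _ _ h0 ht, div_eq_mul_inv p k, div_eq_mul_inv p k',
      ← mul_add, hconj.inv_add_inv_eq_one, mul_one, ← ENNReal.mul_rpow_of_nonneg _ _ hp.le,
      ENNReal.div_mul_cancel h0 ht]
  have h2 : ∀ x, ((f x / W x) ^ p * W x ^ (p / k)) ^ k = (f x / W x) ^ q * W x ^ p := fun x => by
    rw [ENNReal.mul_rpow_of_nonneg _ _ hk0.le, ← ENNReal.rpow_mul, ← ENNReal.rpow_mul,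
      div_mul_cancel₀ _ hk0.ne', hk, mul_div_cancel₀ _ hp.ne']
  have h3 : ∀ x, (W x ^ (p / k')) ^ k' = W x ^ p := fun x => by
    rw [← ENNReal.rpow_mul, div_mul_cancel₀ _ hk'0.ne']
  rw [← h1] at hH
  simp only [h2, h3] at hH
  refine (ENNReal.rpow_le_rpow hH hk0.le).trans (le_of_eq ?_)
  rw [ENNReal.mul_rpow_of_nonneg _ _ hk0.le, ← ENNReal.rpow_mul, ← ENNReal.rpow_mul,
    one_div_mul_cancel hk0.ne', ENNReal.rpow_one]
  congr 2
  have := hconj.inv_add_inv_eq_one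
  have e : k'⁻¹ = 1 - k⁻¹ := by linarith
  rw [one_div, e, sub_mul, one_mul, inv_mul_cancel₀ hk0.ne']

section

variable {Ω : Type*} [MeasurableSpace Ω] {P : Measure Ω} [IsProbabilityMeasure P] {v : ℝ≥0}
  {g : ℕ → Ω → ℂ}

/-- After the weighted Hölder inequality, Tonelli brings the expectation inside, where the moment of
order `2m` of the sum divided by `W x` is bounded uniformly in `x`. What remains is `I * I ^ (k - 1)
= I ^ k` with `k = 2m / p`. -/
lemma IsGaussianSeq.lintegral_lintegral_rpow_le (hg : IsGaussianSeq P v g) {X : Type*}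
    [MeasurableSpace X] {κ : Measure X} [SFinite κ] (S : Finset ℕ) {z : ℕ → X → ℂ}
    (hz : ∀ n, Measurable (z n)) {W : X → ℝ} (hW : Measurable W) (hW0 : ∀ᵐ x ∂κ, 0 < W x)
    (hzW : ∀ᵐ x ∂κ, ∑ n ∈ S, ‖z n x‖ ^ 2 ≤ W x ^ 2) {p : ℝ} (hp : 0 < p) {m : ℕ}
    (hm : p < (2 * m : ℕ)) :
    ∫⁻ w, (∫⁻ x, ‖∑ n ∈ S, z n x * g n w‖ₑ ^ p ∂κ) ^ ((2 * m : ℕ) / p) ∂P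
      ≤ ENNReal.ofReal (momentConst v m)
        * (∫⁻ x, ENNReal.ofReal (W x) ^ p ∂κ) ^ ((2 * m : ℕ) / p) := by
  have hgm := hg.meas
  set I := ∫⁻ x, ENNReal.ofReal (W x) ^ p ∂κ with hI
  have hk1 : 1 < ((2 * m : ℕ) : ℝ) / p := by rwa [one_lt_div hp]
  have hWt : ∀ᵐ x ∂κ, ENNReal.ofReal (W x) ≠ ⊤ := ae_of_all _ fun _ => ENNReal.ofReal_ne_top
  have hW0' : ∀ᵐ x ∂κ, ENNReal.ofReal (W x) ≠ 0 := by
    filter_upwards [hW0] with x hx using by simpa using hx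
  have hstep : ∀ w, (∫⁻ x, ‖∑ n ∈ S, z n x * g n w‖ₑ ^ p ∂κ) ^ ((2 * m : ℕ) / p) ≤
      (∫⁻ x, (‖∑ n ∈ S, z n x * g n w‖ₑ / ENNReal.ofReal (W x)) ^ ((2 * m : ℕ) : ℝ)
        * ENNReal.ofReal (W x) ^ p ∂κ) * I ^ ((2 * m : ℕ) / p - 1) := fun w =>
    lintegral_rpow_rpow_le_of_weight (by fun_prop) (by fun_prop) hW0' hWt hp hm
  refine (lintegral_mono hstep).trans ?_
  have hF : Measurable (Function.uncurry fun (w : Ω) (x : X) =>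
      (‖∑ n ∈ S, z n x * g n w‖ₑ / ENNReal.ofReal (W x)) ^ ((2 * m : ℕ) : ℝ)
        * ENNReal.ofReal (W x) ^ p) := by
    unfold Function.uncurry
    fun_prop
  rw [lintegral_mul_const _ hF.lintegral_prod_right, lintegral_lintegral_swap hF.aemeasurable]
  have hx : ∀ᵐ x ∂κ, ∫⁻ w, (‖∑ n ∈ S, z n x * g n w‖ₑ / ENNReal.ofReal (W x)) ^ ((2 * m : ℕ) : ℝ)
        * ENNReal.ofReal (W x) ^ p ∂P
      ≤ ENNReal.ofReal (momentConst v m) * ENNReal.ofReal (W x) ^ p := by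
    filter_upwards [hW0, hzW] with x hx0 hxz
    rw [lintegral_mul_const _ (by fun_prop)]
    gcongr
    simp only [ENNReal.rpow_natCast, div_eq_mul_inv, mul_pow]
    rw [lintegral_mul_const _ (by fun_prop)]
    have := hg.lintegral_norm_pow_le S (fun n => z n x) m hx0 hxz
    refine (mul_le_mul_left this _).trans (le_of_eq ?_)
    rw [ENNReal.ofReal_mul (momentConst_nonneg _ _), mul_assoc, ENNReal.ofReal_pow hx0.le,
      ← mul_pow, ENNReal.mul_inv_cancel (by simpa using hx0) ENNReal.ofReal_ne_top, one_pow,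
      mul_one]
  refine (mul_le_mul_left (lintegral_mono_ae hx) _).trans (le_of_eq ?_)
  rw [lintegral_const_mul _ (by fun_prop), mul_assoc, ← hI]
  congr 1
  conv_lhs => rw [← ENNReal.rpow_one I, ← ENNReal.rpow_mul, one_mul]
  rw [← ENNReal.rpow_add_of_nonneg _ _ zero_le_one (by linarith)]
  congr 1
  ring

end

/-! ### Events that hold from some index on. -/

/-- The event is an increasing union of tail intersections, each contained in some `s n` of measure
at most `b`. Continuity from below along an increasing union needs no measurability, so the sets
`Π_{N,i}` can be treated without proving them measurable. -/
lemma measure_eventually_mem_le {Ω : Type*} [MeasurableSpace Ω] {P : Measure Ω}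
    {s : ℕ → Set Ω} {b : ℝ≥0∞} (h : ∀ᶠ n in atTop, P (s n) ≤ b) :
    P {w | ∀ᶠ n in atTop, w ∈ s n} ≤ b := by
  have e : {w | ∀ᶠ n in atTop, w ∈ s n} = ⋃ M, ⋂ n ≥ M, s n := by
    ext w; simp [eventually_atTop]
  have hmono : Monotone fun M => ⋂ n ≥ M, s n := fun a b hab =>
    biInter_subset_biInter_left fun n (hn : b ≤ n) => hab.trans hn
  rw [e, hmono.directed_le.measure_iUnion]
  refine iSup_le fun M => ?_
  obtain ⟨n, hn, hM⟩ := (h.and (eventually_ge_atTop M)).exists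
  exact (measure_mono (biInter_subset_of_mem hM)).trans hn

/-- Markov's inequality for the limes inferior of a sequence of random variables. -/
lemma measure_lt_liminf_le {Ω : Type*} [MeasurableSpace Ω] {P : Measure Ω} {f : ℕ → Ω → ℝ≥0∞}
    (hf : ∀ M, Measurable (f M)) {k : ℝ} (hk : 0 < k)
    {C l : ℝ≥0∞} (hl : l ≠ 0) (hlt : l ≠ ⊤) (hC : ∀ M, ∫⁻ w, f M w ^ k ∂P ≤ C) :
    P {w | l < liminf (fun M => f M w) atTop} ≤ C / l ^ k := by
  have hsub : {w | l < liminf (fun M => f M w) atTop}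
      ⊆ {w | ∀ᶠ M in atTop, w ∈ {w | l ≤ f M w}} := fun w hw => by
    have := eventually_lt_of_lt_liminf (u := fun M => f M w) hw
    exact this.mono fun M hM => le_of_lt hM
  refine (measure_mono hsub).trans (measure_eventually_mem_le (Eventually.of_forall fun M => ?_))
  have h : {w | l ≤ f M w} ⊆ {w | l ^ k ≤ f M w ^ k} := fun w hw => ENNReal.rpow_le_rpow hw hk.le
  refine (measure_mono h).trans ?_
  refine (meas_ge_le_lintegral_div ((hf M).pow_const k).aemeasurable
    (by simp [hl, hk.le]) (by simp [hk.le, hlt])).trans ?_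
  gcongr
  exact hC M

/-! ### Radial integrals and bounds on the eigenfunctions -/

lemma ae_ballMeasure_ne_zero : ∀ᵐ x ∂ballMeasure, x ≠ 0 := by
  unfold ballMeasure
  refine ae_restrict_of_ae ?_
  rw [ae_iff]
  simp

/-- In polar coordinates the integrand is a constant times `r ^ (2 - a p)`, integrable at 0 exactly
when `a p < 3`. -/
lemma lintegral_weight_lt_top {a p C : ℝ} (hC : 0 ≤ C) (hp : 0 < p) (hap : a * p < 3) :
    ∫⁻ x, ENNReal.ofReal (C * ‖x‖ ^ (-a)) ^ p ∂ballMeasure < ⊤ := by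
  have h1 : IntegrableOn (fun x : EuclideanSpace ℝ (Fin 3) => ‖x‖ ^ (-(a * p)))
      (Metric.ball 0 1) := by
    rw [integrableOn_fun_norm_addHaar volume (f := fun y : ℝ => y ^ (-(a * p)))]
    have h2 : IntegrableOn (fun y : ℝ => y ^ (2 - a * p)) (Ioo 0 1) :=
      (intervalIntegral.integrableOn_Ioo_rpow_iff one_pos).2 (by linarith)
    refine h2.congr_fun (fun y hy => ?_) measurableSet_Ioo
    simp only [finrank_euclideanSpace, Fintype.card_fin, smul_eq_mul]
    rw [sub_eq_add_neg, Real.rpow_add hy.1]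
    norm_num
  have h3 : Integrable (fun x : EuclideanSpace ℝ (Fin 3) => C ^ p * ‖x‖ ^ (-(a * p)))
      ballMeasure := h1.const_mul _
  have h4 : ∀ x : EuclideanSpace ℝ (Fin 3), ENNReal.ofReal (C * ‖x‖ ^ (-a)) ^ p
      = ENNReal.ofReal (C ^ p * ‖x‖ ^ (-(a * p))) := fun x => by
    rw [ENNReal.ofReal_rpow_of_nonneg (by positivity) hp.le, Real.mul_rpow hC (by positivity),
      ← Real.rpow_mul (norm_nonneg _)]
    congr 3; ring
  simp only [h4]
  exact h3.lintegral_lt_top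

/-- The square of the `L²` norm of each of the eigenfunctions. -/
def eigenNormSq : ℝ :=
  3 * ((volume : Measure (EuclideanSpace ℝ (Fin 3))).real (Metric.ball 0 1) / (2 * Real.pi))

lemma eigenNormSq_pos : 0 < eigenNormSq := by
  unfold eigenNormSq
  have : 0 < (volume : Measure (EuclideanSpace ℝ (Fin 3))).real (Metric.ball 0 1) :=
    ENNReal.toReal_pos (Metric.measure_ball_pos _ _ one_pos).ne' measure_ball_lt_top.ne
  have := Real.pi_pos
  positivity

/-- The radial Jacobian cancels the `r²` in the denominator and leaves `∫ sin² = 1/2`. What matters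
is that the value, which is 2, does not depend on `n`: the eigenfunctions are orthogonal with a
common norm, and one constant normalises the potential. -/
lemma integral_eigenfun_sq (n : ℕ) : ∫ x, eigenfun n x ^ 2 ∂ballMeasure = eigenNormSq := by
  set f : ℝ → ℝ := (Iio (1 : ℝ)).indicator
    fun r => (Real.sin (freq n * r) / (Real.sqrt Real.pi * r)) ^ 2 with hf
  have h1 : ∫ x, eigenfun n x ^ 2 ∂ballMeasure
      = ∫ x : EuclideanSpace ℝ (Fin 3), f ‖x‖ := by
    unfold ballMeasure
    rw [← integral_indicator Metric.isOpen_ball.measurableSet]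
    congr 1; ext x
    simp [hf, indicator, eigenfun]
  have hpi := Real.pi_pos
  have hfr := freq_pos n
  have h2 : ∫ y in Ioi (0 : ℝ), y ^ 2 • f y
      = ∫ y in (0 : ℝ)..1, Real.pi⁻¹ * Real.sin (freq n * y) ^ 2 := by
    rw [intervalIntegral.integral_of_le zero_le_one, integral_Ioc_eq_integral_Ioo,
      ← integral_indicator measurableSet_Ioi, ← integral_indicator measurableSet_Ioo]
    congr 1; ext y
    simp only [indicator, mem_Ioi, mem_Ioo, hf, mem_Iio, smul_eq_mul]
    by_cases h0 : 0 < y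
    · by_cases h1 : y < 1
      · simp only [h0, h1, and_self, if_true]
        rw [div_pow, mul_pow, Real.sq_sqrt hpi.le]
        field_simp
      · simp [h0, h1]
    · simp [h0]
  have h3 : ∫ y in (0 : ℝ)..1, Real.sin (freq n * y) ^ 2 = 1 / 2 := by
    rw [intervalIntegral.integral_comp_mul_left (fun y => Real.sin y ^ 2) hfr.ne',
      integral_sin_sq]
    have e : Real.sin (freq n * 1) = 0 := by
      unfold freq
      have := Real.sin_nat_mul_pi (n + 1)
      push_cast at this
      simpa using this
    rw [e]
    simp
    field_simp
  rw [h1, integral_fun_norm_addHaar volume f]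
  simp only [finrank_euclideanSpace, Fintype.card_fin, Nat.add_one_sub_one]
  rw [h2, intervalIntegral.integral_const_mul, h3, eigenNormSq]
  simp only [nsmul_eq_mul, smul_eq_mul]
  push_cast
  field_simp

lemma abs_sin_le_rpow {y b : ℝ} (hy : 0 < y) (hb : 0 ≤ b) (hb1 : b ≤ 1) :
    |Real.sin y| ≤ y ^ b := by
  rcases le_total y 1 with h | h
  · calc |Real.sin y| ≤ y := Real.abs_sin_le_abs.trans (abs_of_pos hy).le
      _ = y ^ (1 : ℝ) := (Real.rpow_one y).symm
      _ ≤ y ^ b := Real.rpow_le_rpow_of_exponent_ge hy h hb1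
  · exact (Real.abs_sin_le_one y).trans (Real.one_le_rpow h hb)

/-- Interpolating between `|sin y| ≤ y` and `|sin y| ≤ 1` with exponent `1 - a` trades the
singularity at the origin against decay in the frequency. -/
lemma sq_eigenfun_div_freq_le {a : ℝ} (ha : 0 ≤ a) (ha1 : a ≤ 1) (n : ℕ)
    {x : EuclideanSpace ℝ (Fin 3)} (hx : x ≠ 0) :
    (eigenfun n x / freq n) ^ 2 ≤ freq n ^ (-(2 * a)) * (‖x‖ ^ (-a)) ^ 2 := by
  have hr : 0 < ‖x‖ := norm_pos_iff.2 hx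
  have hf := freq_pos n
  have hpi : 1 ≤ Real.sqrt Real.pi := by
    rw [Real.one_le_sqrt]; linarith [Real.pi_gt_three]
  have h1 : |eigenfun n x / freq n| ≤ freq n ^ (-a) * ‖x‖ ^ (-a) := by
    unfold eigenfun
    rw [abs_div, abs_div, abs_of_pos hf, abs_of_pos (by positivity : 0 < Real.sqrt Real.pi * ‖x‖),
      div_div, div_le_iff₀ (by positivity), ← Real.mul_rpow hf.le hr.le]
    refine (abs_sin_le_rpow (by positivity) (sub_nonneg.2 ha1) (by linarith)).trans ?_
    rw [show 1 - a = -a + 1 by ring, Real.rpow_add (by positivity), Real.rpow_one]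
    refine mul_le_mul_of_nonneg_left ?_ (by positivity)
    nlinarith [mul_pos hf hr]
  have e : freq n ^ (-(2 * a)) = (freq n ^ (-a)) ^ 2 := by
    rw [← Real.rpow_natCast, ← Real.rpow_mul hf.le]; congr 1; push_cast; ring
  rw [e, ← mul_pow, ← sq_abs]
  exact pow_le_pow_left₀ (abs_nonneg _) h1 2

lemma summable_freq_rpow {s : ℝ} (hs : s < -1) : Summable fun n => freq n ^ s := by
  have h : Summable fun n : ℕ => (n : ℝ) ^ s := Real.summable_nat_rpow.2 hs
  have h2 := ((summable_nat_add_iff 1).2 h).mul_right (Real.pi ^ s)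
  refine h2.congr fun n => ?_
  rw [freq, Real.mul_rpow (by positivity) Real.pi_pos.le]
  push_cast; rfl

/-- For `a > 1/2` the series `∑ freq n ^ (-2a)` converges. This bounds the variance of the Gaussian
series at `x`, whatever the number of terms. -/
lemma exists_sum_sq_eigenfun_div_freq_le {a : ℝ} (ha : 1 / 2 < a) (ha1 : a ≤ 1) :
    ∃ C : ℝ, 0 < C ∧ ∀ (S : Finset ℕ) (x : EuclideanSpace ℝ (Fin 3)), x ≠ 0 →
      ∑ n ∈ S, (eigenfun n x / freq n) ^ 2 ≤ (C * ‖x‖ ^ (-a)) ^ 2 := by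
  have hs : Summable fun n => freq n ^ (-(2 * a)) := summable_freq_rpow (by linarith)
  have hpos : ∀ n, 0 ≤ freq n ^ (-(2 * a)) := fun n => (Real.rpow_pos_of_pos (freq_pos n) _).le
  have hC : 0 < ∑' n, freq n ^ (-(2 * a)) :=
    hs.tsum_pos hpos 0 (Real.rpow_pos_of_pos (freq_pos 0) _)
  refine ⟨Real.sqrt (∑' n, freq n ^ (-(2 * a))), Real.sqrt_pos.2 hC, fun S x hx => ?_⟩
  rw [mul_pow, Real.sq_sqrt hC.le]
  calc _ ≤ ∑ n ∈ S, freq n ^ (-(2 * a)) * (‖x‖ ^ (-a)) ^ 2 :=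
        Finset.sum_le_sum fun n _ => sq_eigenfun_div_freq_le (by linarith) ha1 n hx
    _ = (∑ n ∈ S, freq n ^ (-(2 * a))) * (‖x‖ ^ (-a)) ^ 2 := by rw [Finset.sum_mul]
    _ ≤ _ := mul_le_mul_of_nonneg_right (hs.sum_le_tsum S fun n _ => hpos n) (by positivity)

/-! ### Space-time and Sobolev functionals on coefficient sequences -/

/-- The function `∑_{n < M} e^{i n π t} c_n e_n` of `(t, x)`. -/
def freeSum (M : ℕ) (c : ℕ → ℂ) (t : ℝ) (x : EuclideanSpace ℝ (Fin 3)) : ℂ :=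
  ∑ n ∈ Finset.range M, Complex.exp (Complex.I * freq n * t) * c n * eigenfun n x

/-- The `p`-th power of the space-time norm of a partial sum. -/
def freeInt (p : ℝ) (M : ℕ) (c : ℕ → ℂ) : ℝ≥0∞ :=
  ∫⁻ t in Icc (0 : ℝ) 2, ∫⁻ x, ‖freeSum M c t x‖ₑ ^ p ∂ballMeasure

/-- The square of the norm of `H^σ`, possibly infinite. -/
def sobolevSq (σ : ℝ) (c : ℕ → ℂ) : ℝ≥0∞ := ∑' n, ‖((freq n ^ σ : ℝ) : ℂ) * c n‖ₑ ^ (2 : ℝ)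

/-- The sequences with space-time norm and Sobolev norm at most `D`; the space-time norm is
replaced by the limes inferior of those of the partial sums. -/
def goodSeq (σ p D : ℝ) : Set (ℕ → ℂ) :=
  {c | liminf (fun M => freeInt p M c) atTop ≤ ENNReal.ofReal (D ^ p) ∧
    sobolevSq σ c ≤ ENNReal.ofReal (D ^ (2 : ℝ))}

lemma measurable_freeSum (M : ℕ) (c : ℕ → ℂ) :
    Measurable fun q : ℝ × EuclideanSpace ℝ (Fin 3) => freeSum M c q.1 q.2 := by
  have := measurable_eigenfun
  unfold freeSum
  fun_prop

lemma freeInt_eq (p : ℝ) (M : ℕ) (c : ℕ → ℂ) :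
    freeInt p M c = ∫⁻ q, ‖freeSum M c q.1 q.2‖ₑ ^ p
      ∂((volume.restrict (Icc (0 : ℝ) 2)).prod ballMeasure) := by
  have := measurable_freeSum M c
  rw [lintegral_prod _ (by fun_prop)]
  rfl

lemma measurable_freeInt (p : ℝ) (M : ℕ) : Measurable (freeInt p M) := by
  have := measurable_eigenfun
  have e : freeInt p M = fun c => ∫⁻ q, ‖freeSum M c q.1 q.2‖ₑ ^ p
      ∂((volume.restrict (Icc (0 : ℝ) 2)).prod ballMeasure) := by
    ext c; exact freeInt_eq p M c
  rw [e]
  refine Measurable.lintegral_prod_right'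
    (f := fun q : (ℕ → ℂ) × (ℝ × EuclideanSpace ℝ (Fin 3)) =>
      ‖freeSum M q.1 q.2.1 q.2.2‖ₑ ^ p) ?_
  unfold freeSum
  fun_prop

lemma norm_exp_I_freq (n : ℕ) (t : ℝ) : ‖Complex.exp (Complex.I * freq n * t)‖ = 1 := by
  rw [Complex.norm_exp]; simp

section

variable {Ω : Type*} [MeasurableSpace Ω] {P : Measure Ω} {v : ℝ≥0}
  {g : ℕ → Ω → ℂ}

variable [IsProbabilityMeasure P]

/-- The constant does not depend on the multiplier `θ`, so one bound serves the data evolved to any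
time and projected on low or high modes. Polynomial decay of large order is enough because `D_{i,j}`
grows like a power of `j`. -/
lemma IsGaussianSeq.exists_freeInt_tail (hg : IsGaussianSeq P v g) {p : ℝ} (hp : 4 < p)
    (hp' : p < 6) {m : ℕ} (hm : p < (2 * m : ℕ)) :
    ∃ C : ℝ≥0∞, C ≠ ⊤ ∧ ∀ θ : ℕ → ℂ, (∀ n, ‖θ n‖ ≤ 1) → ∀ D : ℝ, 0 < D →
      P {w | ENNReal.ofReal (D ^ p) < liminf (fun M => freeInt p M fun n => θ n * g n w / freq n)
        atTop} ≤ C / ENNReal.ofReal D ^ (2 * m) := by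
  have hp0 : 0 < p := by linarith
  have h3 : 1 / 2 < 3 / p := by rw [div_lt_div_iff₀ two_pos hp0]; linarith
  have h3' : 3 / p < 1 := by rw [div_lt_one hp0]; linarith
  -- The midpoint of `1/2` and `3 / p`: above `1/2` for the variance to converge, below `3 / p` for
  -- the weight to lie in `L^p`.
  set a := (1 / 2 + 3 / p) / 2 with ha
  have hap : a * p < 3 := by
    have : a < 3 / p := by linarith
    calc a * p < 3 / p * p := by gcongr
      _ = 3 := div_mul_cancel₀ _ hp0.ne'
  obtain ⟨C, hC, hCs⟩ := exists_sum_sq_eigenfun_div_freq_le (a := a) (by linarith) (by linarith)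
  set κ := (volume.restrict (Icc (0 : ℝ) 2)).prod ballMeasure
  set I := ∫⁻ q, ENNReal.ofReal (C * ‖q.2‖ ^ (-a)) ^ p ∂κ with hI
  have hIt : I ≠ ⊤ := by
    rw [hI, lintegral_prod _ (by fun_prop)]
    simp only [lintegral_const]
    refine ENNReal.mul_ne_top (lintegral_weight_lt_top hC.le hp0 hap).ne ?_
    simp
  refine ⟨ENNReal.ofReal (momentConst v m) * I ^ (((2 * m : ℕ) : ℝ) / p),
    ENNReal.mul_ne_top ENNReal.ofReal_ne_top (ENNReal.rpow_ne_top_of_nonneg (by positivity) hIt),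
    fun θ hθ D hD => ?_⟩
  have hgm := hg.meas
  have hk : 0 < ((2 * m : ℕ) : ℝ) / p := div_pos (by linarith) hp0
  have hmain := measure_lt_liminf_le (P := P)
    (f := fun M w => freeInt p M fun n => θ n * g n w / freq n)
    (fun M => (measurable_freeInt p M).comp (by fun_prop)) hk
    (l := ENNReal.ofReal (D ^ p)) (C := ENNReal.ofReal (momentConst v m) * I ^ ((2 * m : ℕ) / p))
    (by simpa using Real.rpow_pos_of_pos hD p) ENNReal.ofReal_ne_top ?_
  · refine hmain.trans (le_of_eq ?_)
    congr 1
    rw [ENNReal.ofReal_rpow_of_nonneg (by positivity) hk.le, ← Real.rpow_mul hD.le,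
      mul_div_cancel₀ _ hp0.ne', Real.rpow_natCast, ENNReal.ofReal_pow hD.le]
  intro M
  have hmeas := measurable_eigenfun
  have hae : ∀ᵐ q ∂κ, q.2 ≠ 0 :=
    (Measure.quasiMeasurePreserving_snd (μ := volume.restrict (Icc (0 : ℝ) 2))
      (ν := ballMeasure)).ae ae_ballMeasure_ne_zero
  have := hg.lintegral_lintegral_rpow_le (κ := κ) (Finset.range M)
    (z := fun n q => Complex.exp (Complex.I * freq n * q.1) * θ n * (eigenfun n q.2 / freq n : ℝ))
    (fun n => by fun_prop) (W := fun q => C * ‖q.2‖ ^ (-a)) (by fun_prop)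
    (by filter_upwards [hae] with q hq
        have := norm_pos_iff.2 hq
        positivity)
    (by filter_upwards [hae] with q hq
        refine le_trans (Finset.sum_le_sum fun n _ => ?_) (hCs (Finset.range M) q.2 hq)
        rw [norm_mul, norm_mul, norm_exp_I_freq, one_mul, Complex.norm_real, mul_pow,
          Real.norm_eq_abs, sq_abs]
        exact mul_le_of_le_one_left (sq_nonneg _) (pow_le_one₀ (norm_nonneg _) (hθ n)))
    hp0 hm
  refine le_trans (le_of_eq ?_) this
  refine lintegral_congr fun w => ?_
  rw [freeInt_eq]
  congr 1
  refine lintegral_congr fun q => ?_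
  unfold freeSum
  congr 2
  refine Finset.sum_congr rfl fun n _ => ?_
  push_cast
  ring

lemma IsGaussianSeq.exists_sobolevSq_tail (hg : IsGaussianSeq P v g) {σ : ℝ}
    (hσ' : σ < 1 / 2) {m : ℕ} (hm : 1 < m) :
    ∃ C : ℝ≥0∞, C ≠ ⊤ ∧ ∀ θ : ℕ → ℂ, (∀ n, ‖θ n‖ ≤ 1) → ∀ D : ℝ, 0 < D →
      P {w | ENNReal.ofReal (D ^ (2 : ℝ)) < sobolevSq σ fun n => θ n * g n w / freq n}
        ≤ C / ENNReal.ofReal D ^ (2 * m) := by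
  have hgm := hg.meas
  have hm2 : (2 : ℝ) < (2 * m : ℕ) := by
    have : 2 < 2 * m := by omega
    exact_mod_cast this
  set I := ∫⁻ k, ENNReal.ofReal (freq k ^ (σ - 1)) ^ (2 : ℝ) ∂Measure.count with hI
  have hIt : I ≠ ⊤ := by
    rw [hI, lintegral_count]
    have h : ∀ k, ENNReal.ofReal (freq k ^ (σ - 1)) ^ (2 : ℝ)
        = ENNReal.ofReal (freq k ^ (2 * σ - 2)) := fun k => by
      rw [ENNReal.ofReal_rpow_of_nonneg (Real.rpow_nonneg (freq_pos k).le _) two_pos.le,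
        ← Real.rpow_mul (freq_pos k).le]
      congr 2; ring
    simp only [h]
    exact (summable_freq_rpow (by linarith)).tsum_ofReal_ne_top
  refine ⟨ENNReal.ofReal (momentConst v m) * I ^ (((2 * m : ℕ) : ℝ) / 2),
    ENNReal.mul_ne_top ENNReal.ofReal_ne_top (ENNReal.rpow_ne_top_of_nonneg (by positivity) hIt),
    fun θ hθ D hD => ?_⟩
  have hk : 0 < ((2 * m : ℕ) : ℝ) / 2 := by linarith
  have hlim : ∀ c, sobolevSq σ c = liminf (fun M => ∑ n ∈ Finset.range M,
      ‖((freq n ^ σ : ℝ) : ℂ) * c n‖ₑ ^ (2 : ℝ)) atTop := fun c =>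
    (ENNReal.tendsto_nat_tsum _).liminf_eq.symm
  simp only [hlim]
  have hmain := measure_lt_liminf_le (P := P)
    (f := fun M w => ∑ n ∈ Finset.range M,
      ‖((freq n ^ σ : ℝ) : ℂ) * (θ n * g n w / freq n)‖ₑ ^ (2 : ℝ)) (fun M => by fun_prop) hk
    (l := ENNReal.ofReal (D ^ (2 : ℝ)))
    (C := ENNReal.ofReal (momentConst v m) * I ^ (((2 * m : ℕ) : ℝ) / 2))
    (by simpa using hD.ne') ENNReal.ofReal_ne_top ?_
  · refine hmain.trans (le_of_eq ?_)
    congr 1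
    rw [ENNReal.ofReal_rpow_of_nonneg (by positivity) hk.le, ← Real.rpow_mul hD.le,
      mul_div_cancel₀ _ two_ne_zero, Real.rpow_natCast, ENNReal.ofReal_pow hD.le]
  intro M
  -- The Sobolev norm is an `L²` norm over `ℕ` with counting measure. The matrix `z` is diagonal,
  -- and the weight `freq k ^ (σ - 1)` is square summable because `2σ - 2 < -1`.
  have := hg.lintegral_lintegral_rpow_le (κ := (Measure.count : Measure ℕ)) (Finset.range M)
    (z := fun n k => if n = k then ((freq n ^ σ : ℝ) : ℂ) * (θ n / freq n) else 0)
    (fun n => measurable_from_nat) (W := fun k => freq k ^ (σ - 1)) measurable_from_nat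
    (ae_of_all _ fun k => Real.rpow_pos_of_pos (freq_pos k) _)
    (ae_of_all _ fun k => by
      have hf := freq_pos k
      have : ∀ n ∈ Finset.range M, ‖(if n = k then ((freq n ^ σ : ℝ) : ℂ) * (θ n / freq n) else 0)‖ ^ 2
          ≤ if n = k then (freq k ^ (σ - 1)) ^ 2 else 0 := fun n _ => by
        split_ifs with h
        · subst h
          refine pow_le_pow_left₀ (norm_nonneg _) ?_ 2
          rw [norm_mul, norm_div, Complex.norm_real, Complex.norm_real,
            Real.norm_of_nonneg (Real.rpow_nonneg hf.le _), Real.norm_of_nonneg hf.le,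
            Real.rpow_sub_one hf.ne', ← mul_div_assoc]
          gcongr
          exact mul_le_of_le_one_right (Real.rpow_nonneg hf.le _) (hθ n)
        · simp
      refine (Finset.sum_le_sum this).trans ?_
      rw [Finset.sum_ite_eq']
      split_ifs
      · exact le_rfl
      · positivity)
    two_pos hm2
  refine le_trans (le_of_eq ?_) this
  refine lintegral_congr fun w => ?_
  congr 1
  rw [lintegral_count, tsum_eq_sum (s := Finset.range M)]
  · refine Finset.sum_congr rfl fun k hk => ?_
    congr 2
    simp only [ite_mul, zero_mul, Finset.sum_ite_eq', hk, if_true]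
    ring
  · intro k hk
    simp only [ite_mul, zero_mul, Finset.sum_ite_eq', hk, if_false]
    simp

lemma IsGaussianSeq.exists_goodSeq_tail (hg : IsGaussianSeq P v g) {σ p : ℝ}
    (hσ' : σ < 1 / 2) (hp : 4 < p) (hp' : p < 6) {m : ℕ} (hm : 3 ≤ m) :
    ∃ C : ℝ≥0∞, C ≠ ⊤ ∧ ∀ θ : ℕ → ℂ, (∀ n, ‖θ n‖ ≤ 1) → ∀ D : ℝ, 0 < D →
      P {w | (fun n => θ n * g n w / freq n) ∉ goodSeq σ p D}
        ≤ C / ENNReal.ofReal D ^ (2 * m) := by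
  have hpm : p < (2 * m : ℕ) := by
    have : ((6 : ℕ) : ℝ) ≤ (2 * m : ℕ) := by exact_mod_cast (by omega : 6 ≤ 2 * m)
    push_cast at this ⊢
    linarith
  obtain ⟨C₁, h₁, H₁⟩ := hg.exists_freeInt_tail hp hp' hpm
  obtain ⟨C₂, h₂, H₂⟩ := hg.exists_sobolevSq_tail hσ' (m := m) (by omega)
  refine ⟨C₁ + C₂, ENNReal.add_ne_top.2 ⟨h₁, h₂⟩, fun θ hθ D hD => ?_⟩
  rw [ENNReal.add_div]
  refine le_trans (le_trans (measure_mono fun w hw => ?_) (measure_union_le _ _))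
    (add_le_add (H₁ θ hθ D hD) (H₂ θ hθ D hD))
  simp only [goodSeq, mem_ofPred_eq, not_and_or, not_le] at hw
  exact hw

end

section

open HSob

/-! ### From coefficient sequences to the sets `A(D)` -/

/-- Any `y` above the limes inferior bounds the integrals along a subsequence; a further subsequence
converges almost everywhere, and Fatou applies to it. -/
lemma lintegral_rpow_le_liminf_of_tendsto_Lp {X : Type*} [MeasurableSpace X] {κ : Measure X}
    {F : ℕ → Lp ℂ 2 κ} {G : Lp ℂ 2 κ} (h : Tendsto F atTop (nhds G)) (p : ℝ) :
    ∫⁻ x, ‖G x‖ₑ ^ p ∂κ ≤ liminf (fun M => ∫⁻ x, ‖F M x‖ₑ ^ p ∂κ) atTop := by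
  refine le_of_forall_gt_imp_ge_of_dense fun y hy => ?_
  have hfreq : ∃ᶠ M in atTop, ∫⁻ x, ‖F M x‖ₑ ^ p ∂κ < y := frequently_lt_of_liminf_lt (by isBoundedDefault) hy
  obtain ⟨φ, hφ, hφy⟩ := extraction_of_frequently_atTop hfreq
  obtain ⟨ψ, hψ, hae⟩ := (tendstoInMeasure_of_tendsto_Lp (h.comp hφ.tendsto_atTop)).exists_seq_tendsto_ae
  have h1 : ∫⁻ x, ‖G x‖ₑ ^ p ∂κ ≤ liminf (fun M => ∫⁻ x, ‖F (φ (ψ M)) x‖ₑ ^ p ∂κ) atTop := by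
    refine le_trans (le_of_eq (lintegral_congr_ae ?_)) (lintegral_liminf_le' fun M => ?_)
    · filter_upwards [hae] with x hx
      exact (((ENNReal.continuous_rpow_const (y := p)).tendsto _).comp
        (continuous_enorm.tendsto _ |>.comp hx)).liminf_eq.symm
    · exact ((Lp.aestronglyMeasurable (F (φ (ψ M)))).enorm).pow_const p
  exact h1.trans (liminf_le_of_frequently_le' (Frequently.of_forall fun M => (hφy (ψ M)).le))

lemma lintegral_toL2_rpow_le {σ p : ℝ} (hp : 0 < p) (u : HSob σ) :
    ∫⁻ x, ‖toL2 u x‖ₑ ^ p ∂ballMeasure ≤ liminf (fun M => ∫⁻ x,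
      ‖∑ n ∈ Finset.range M, coeff u n * eigenfun n x‖ₑ ^ p ∂ballMeasure) atTop := by
  by_cases hs : Summable fun n => coeff u n • eigenL2 n
  · refine (lintegral_rpow_le_liminf_of_tendsto_Lp hs.hasSum.tendsto_sum_nat p).trans (le_of_eq ?_)
    congr 1; ext M
    refine lintegral_congr_ae ?_
    have h1 : ∀ᵐ x ∂ballMeasure, ∀ n, (coeff u n • eigenL2 n) x = coeff u n * eigenfun n x := by
      rw [ae_all_iff]
      intro n
      filter_upwards [Lp.coeFn_smul (coeff u n) (eigenL2 n), (memLp_eigenfun n).coeFn_toLp]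
        with x h1 h2
      rw [h1, Pi.smul_apply, eigenL2, h2, smul_eq_mul]
    filter_upwards [h1, Lp.coeFn_finsetSum (Finset.range M) fun n => coeff u n • eigenL2 n]
      with x hx h2
    rw [h2, Finset.sum_apply]
    simp only [hx]
  -- If the series diverges in `L²`, `toL2 u` is 0 by the convention on `tsum`, and the bound is
  -- trivial.
  · rw [toL2, tsum_eq_zero_of_not_summable hs]
    refine le_trans (le_of_eq ?_) (zero_le)
    rw [lintegral_eq_zero_iff' (by fun_prop)]
    filter_upwards [Lp.coeFn_zero ℂ 2 ballMeasure] with x hx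
    rw [hx]
    simp [hp]

lemma coeff_S {σ : ℝ} (t : ℝ) (u : HSob σ) (n : ℕ) :
    coeff (S t u) n = Complex.exp (Complex.I * freq n * t) * coeff u n := rfl

lemma spaceTimeNorm_le {σ p : ℝ} (hp : 0 < p) (u : HSob σ) :
    spaceTimeNorm p u ≤ (liminf (fun M => freeInt p M (coeff u)) atTop) ^ (1 / p) := by
  unfold spaceTimeNorm
  refine ENNReal.rpow_le_rpow ?_ (by positivity)
  have h : ∀ t, ∫⁻ x, ‖toL2 (S t u) x‖ₑ ^ p ∂ballMeasure
      ≤ liminf (fun M => ∫⁻ x, ‖freeSum M (coeff u) t x‖ₑ ^ p ∂ballMeasure) atTop := fun t =>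
    lintegral_toL2_rpow_le hp (S t u)
  refine (lintegral_mono h).trans (lintegral_liminf_le fun M => ?_)
  have := measurable_freeSum M (coeff u)
  exact Measurable.lintegral_prod_right' (f := fun q : ℝ × EuclideanSpace ℝ (Fin 3) =>
    ‖freeSum M (coeff u) q.1 q.2‖ₑ ^ p) (by fun_prop)

lemma enorm_sq_eq_sobolevSq {σ : ℝ} (u : HSob σ) :
    ENNReal.ofReal (‖u‖ ^ 2) = sobolevSq σ (coeff u) := by
  have h : ‖u‖ = ‖weighted u‖ := rfl
  have h2 := lp.hasSum_norm (p := 2) (by norm_num) (weighted u)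
  have h3 : ∀ n, (weighted u : ℕ → ℂ) n = ((freq n ^ σ : ℝ) : ℂ) * coeff u n := fun _ => rfl
  simp only [ENNReal.toReal_ofNat, h3] at h2
  rw [h, ← Real.rpow_ofNat, ← h2.tsum_eq,
    ENNReal.ofReal_tsum_of_nonneg (fun n => by positivity) h2.summable]
  refine tsum_congr fun n => ?_
  rw [← ENNReal.ofReal_rpow_of_nonneg (norm_nonneg _) two_pos.le, ofReal_norm]

lemma mem_setA_of_goodSeq {σ p D : ℝ} (hp : 0 < p) (hD : 0 ≤ D) {u : HSob σ}
    (h : coeff u ∈ goodSeq σ p D) : u ∈ setA σ p D := by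
  constructor
  · refine (spaceTimeNorm_le hp u).trans ?_
    refine (ENNReal.rpow_le_rpow h.1 (by positivity)).trans (le_of_eq ?_)
    rw [ENNReal.ofReal_rpow_of_nonneg (by positivity) (by positivity), ← Real.rpow_mul hD,
      mul_one_div_cancel hp.ne', Real.rpow_one]
  · have h2 := h.2
    rw [← enorm_sq_eq_sobolevSq, Real.rpow_ofNat, ENNReal.ofReal_le_ofReal_iff (by positivity)] at h2
    exact le_of_sq_le_sq h2 hD

/-- The part of a sequence of index less than `N`. -/
def lowPart (N : ℕ) (c : ℕ → ℂ) (n : ℕ) : ℂ := if n < N then c n else 0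

/-- The part of a sequence of index at least `N`. -/
def highPart (N : ℕ) (c : ℕ → ℂ) (n : ℕ) : ℂ := if n < N then 0 else c n

lemma freeSum_eq_add (M N : ℕ) (c : ℕ → ℂ) (t : ℝ) (x : EuclideanSpace ℝ (Fin 3)) :
    freeSum M c t x = freeSum M (lowPart N c) t x + freeSum M (highPart N c) t x := by
  unfold freeSum
  rw [← Finset.sum_add_distrib]
  refine Finset.sum_congr rfl fun n _ => ?_
  unfold lowPart highPart
  split_ifs <;> simp

lemma freeSum_lowPart {M N : ℕ} (h : N ≤ M) (c : ℕ → ℂ) : 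
    freeSum M (lowPart N c) = freeSum N (lowPart N c) := by
  ext t x
  unfold freeSum
  symm
  refine Finset.sum_subset (Finset.range_mono h) fun n _ hn => ?_
  simp only [Finset.mem_range] at hn
  simp [lowPart, hn]

lemma freeInt_le_add {p : ℝ} (hp : 1 ≤ p) (M N : ℕ) (c : ℕ → ℂ) :
    freeInt p M c ≤ 2 ^ (p - 1) * (freeInt p M (lowPart N c) + freeInt p M (highPart N c)) := by
  have h1 := measurable_freeSum M (lowPart N c)
  simp only [freeInt_eq]
  rw [← lintegral_add_left (by fun_prop), ← lintegral_const_mul']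
  · refine lintegral_mono fun q => ?_
    rw [freeSum_eq_add M N]
    exact (ENNReal.rpow_le_rpow (enorm_add_le _ _) (by linarith)).trans
      (ENNReal.rpow_add_le_mul_rpow_add_rpow _ _ hp)
  · exact ENNReal.rpow_ne_top_of_nonneg (by linarith) ENNReal.ofNat_ne_top

lemma sobolevSq_eq_add (σ : ℝ) (N : ℕ) (c : ℕ → ℂ) :
    sobolevSq σ c = sobolevSq σ (lowPart N c) + sobolevSq σ (highPart N c) := by
  unfold sobolevSq
  rw [← ENNReal.tsum_add]
  refine tsum_congr fun n => ?_
  unfold lowPart highPart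
  split_ifs <;> simp

/-- The truncated flow moves low and high modes by different laws, so each part is controlled
separately. The factor 4 absorbs the constant of the triangle inequality for `p`-th powers. -/
lemma goodSeq_of_parts {σ p D : ℝ} (hp : 1 ≤ p) (hD : 0 < D) {N : ℕ} {c : ℕ → ℂ}
    (hl : lowPart N c ∈ goodSeq σ p (D / 4)) (hh : highPart N c ∈ goodSeq σ p (D / 4)) :
    c ∈ goodSeq σ p D := by
  have hDp : 0 < (D / 4) ^ p := by positivity
  constructor
  · have hlow : freeInt p N (lowPart N c) ≤ ENNReal.ofReal ((D / 4) ^ p) := by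
      refine le_trans (le_of_eq ?_) hl.1
      have : Tendsto (fun M => freeInt p M (lowPart N c)) atTop
          (nhds (freeInt p N (lowPart N c))) := by
        refine tendsto_const_nhds.congr' ?_
        filter_upwards [eventually_ge_atTop N] with M hM
        simp only [freeInt, freeSum_lowPart hM]
      exact this.liminf_eq.symm
    -- Limites inferiores are not subadditive, but the low part is constant for `M ≥ N`, so it
    -- suffices to use the infinitely many `M` good for the high part. The slack factor 2 makes the
    -- inequality strict; the total is at most `3 * 2 ^ (p - 1) * (D / 4) ^ p ≤ D ^ p`.
    have hfreq : ∃ᶠ M in atTop,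
        freeInt p M (highPart N c) < ENNReal.ofReal (2 * (D / 4) ^ p) := by
      refine frequently_lt_of_liminf_lt (by isBoundedDefault) (hh.1.trans_lt ?_)
      rw [ENNReal.ofReal_lt_ofReal_iff (by positivity)]
      linarith
    refine liminf_le_of_frequently_le' ((hfreq.and_eventually (eventually_ge_atTop N)).mono ?_)
    rintro M ⟨hM, hNM⟩
    refine (freeInt_le_add hp M N c).trans ?_
    have e : freeInt p M (lowPart N c) = freeInt p N (lowPart N c) := by
      simp only [freeInt, freeSum_lowPart hNM]
    rw [e]
    refine (mul_le_mul_right (add_le_add hlow hM.le) _).trans ?_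
    have e2 : (2 : ℝ≥0∞) ^ (p - 1) = ENNReal.ofReal (2 ^ (p - 1)) := by
      rw [← ENNReal.ofReal_rpow_of_pos two_pos]; simp
    rw [e2, ← ENNReal.ofReal_add hDp.le (by positivity), ← ENNReal.ofReal_mul (by positivity)]
    refine ENNReal.ofReal_le_ofReal ?_
    have e3 : D ^ p = 2 ^ p * 2 ^ p * (D / 4) ^ p := by
      rw [← Real.mul_rpow two_pos.le two_pos.le, ← Real.mul_rpow (by norm_num) (by positivity)]
      congr 1; ring
    have e4 : (2 : ℝ) ≤ 2 ^ p := by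
      simpa using Real.rpow_le_rpow_of_exponent_le one_le_two hp
    rw [e3, Real.rpow_sub_one two_ne_zero]
    nlinarith [mul_le_mul_of_nonneg_right e4 (by positivity : (0 : ℝ) ≤ 2 ^ p * (D / 4) ^ p),
      mul_pos (by positivity : (0 : ℝ) < 2 ^ p) hDp]
  · rw [sobolevSq_eq_add σ N]
    refine (add_le_add hl.2 hh.2).trans ?_
    rw [← ENNReal.ofReal_add (by positivity) (by positivity)]
    refine ENNReal.ofReal_le_ofReal ?_
    simp only [Real.rpow_ofNat]
    nlinarith

end

/-! ### Global integral curves -/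

section

variable {E : Type*} [NormedAddCommGroup E] [NormedSpace ℝ E]

lemma exists_integralCurve_Ioo [CompleteSpace E] {f : E → E} {K L : ℝ≥0} (hK : LipschitzWith K f)
    (hL : ∀ x, ‖f x‖ ≤ L) (x₀ : E) {T : ℝ} (hT : 0 < T) :
    ∃ y : ℝ → E, y 0 = x₀ ∧ ∀ t ∈ Ioo (-T) T, HasDerivAt y (f (y t)) t := by
  have h0 : (0 : ℝ) ∈ Icc (-T) T := ⟨by linarith, hT.le⟩
  -- With speed at most `L`, a curve stays within distance `L T` of its origin during time `T`,
  -- hence the radius.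
  have hP : IsPicardLindelof (fun _ : ℝ => f) (⟨0, h0⟩ : Icc (-T) T) x₀ (L * T.toNNReal) 0 L K :=
    { lipschitzOnWith := fun t _ => hK.lipschitzOnWith
      continuousOn := fun x _ => continuousOn_const
      norm_le := fun t _ x _ => hL x
      mul_max_le := by simp [hT.le] }
  obtain ⟨y, hy0, hy⟩ := hP.exists_eq_forall_mem_Icc_hasDerivWithinAt₀
  exact ⟨y, hy0, fun t ht => (hy t (Ioo_subset_Icc_self ht)).hasDerivAt (Icc_mem_nhds ht.1 ht.2)⟩

/-- A bounded Lipschitz vector field has global integral curves. -/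
lemma exists_integralCurve [CompleteSpace E] {f : E → E} {K L : ℝ≥0} (hK : LipschitzWith K f)
    (hL : ∀ x, ‖f x‖ ≤ L) (x₀ : E) :
    ∃ y : ℝ → E, y 0 = x₀ ∧ ∀ t, HasDerivAt y (f (y t)) t := by
  choose Y hY0 hY using fun k : ℕ =>
    exists_integralCurve_Ioo hK hL x₀ (T := (k : ℝ) + 1) (by positivity)
  have hmono : ∀ j k : ℕ, j ≤ k → ∀ s : ℝ, |s| < (j : ℝ) + 1 → Y j s = Y k s := by
    intro j k hjk s hs
    have hjk' : (j : ℝ) ≤ k := by exact_mod_cast hjk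
    have hj : (0 : ℝ) ≤ j := j.cast_nonneg
    refine ODE_solution_unique_of_mem_Ioo (v := fun _ => f) (s := fun _ => univ) (K := K)
      (t₀ := 0) (a := -((j : ℝ) + 1)) (b := (j : ℝ) + 1)
      (fun t _ => hK.lipschitzOnWith) ⟨by linarith, by linarith⟩
      (fun t ht => ⟨hY j t ht, mem_univ _⟩)
      (fun t ht => ⟨hY k t ⟨by linarith [ht.1], by linarith [ht.2]⟩, mem_univ _⟩)
      ((hY0 j).trans (hY0 k).symm) (abs_lt.1 hs)
  have heq : ∀ (k : ℕ) (s : ℝ), |s| < (k : ℝ) + 1 → Y ⌈|s|⌉₊ s = Y k s := fun k s hs => by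
    have h1 : |s| < (⌈|s|⌉₊ : ℝ) + 1 := (Nat.le_ceil _).trans_lt (lt_add_one _)
    rcases le_total ⌈|s|⌉₊ k with h | h
    · exact hmono _ _ h s h1
    · exact (hmono _ _ h s hs).symm
  refine ⟨fun s => Y ⌈|s|⌉₊ s, by simpa using hY0 0, fun t => ?_⟩
  have ht : |t| < (⌈|t|⌉₊ : ℝ) + 1 := (Nat.le_ceil _).trans_lt (lt_add_one _)
  refine (hY ⌈|t|⌉₊ t (abs_lt.1 ht)).congr_of_eventuallyEq ?_
  filter_upwards [(continuous_abs.tendsto t).eventually (gt_mem_nhds ht)] with s hs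
  exact heq _ s hs

lemma exists_integralCurve_of_hasCompactSupport [FiniteDimensional ℝ E] {f : E → E}
    (hf : ContDiff ℝ 1 f) (hc : HasCompactSupport f) (x₀ : E) :
    ∃ y : ℝ → E, y 0 = x₀ ∧ ∀ t, HasDerivAt y (f (y t)) t := by
  have := FiniteDimensional.complete ℝ E
  obtain ⟨L, hL⟩ := hc.exists_bound_of_continuous hf.continuous
  obtain ⟨K, hK⟩ := ContDiff.lipschitzWith_of_hasCompactSupport hc hf one_ne_zero
  exact exists_integralCurve (L := L.toNNReal) hK (fun x => (hL x).trans (Real.le_coe_toNNReal L)) x₀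

end

/-! ### Hamiltonian systems -/

section

variable {ι : Type*} [Fintype ι]

/-- The partial derivatives of a function on `ℝ^ι`. -/
def partials [DecidableEq ι] (V : (ι → ℝ) → ℝ) (a : ι → ℝ) (n : ι) : ℝ :=
  fderiv ℝ V a (Pi.single n 1)

/-- The Hamiltonian `½ ∑ ν_n² (a_n² + b_n²) + V(a)`. -/
def ham (ν : ι → ℝ) (V : (ι → ℝ) → ℝ) (z : (ι → ℝ) × (ι → ℝ)) : ℝ :=
  ∑ n, ν n ^ 2 / 2 * (z.1 n ^ 2 + z.2 n ^ 2) + V z.1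

/-- The vector field `a' = -ν b`, `b' = ν a + ν⁻¹ ∇V(a)`. -/
def hamField [DecidableEq ι] (ν : ι → ℝ) (V : (ι → ℝ) → ℝ) (z : (ι → ℝ) × (ι → ℝ)) :
    (ι → ℝ) × (ι → ℝ) :=
  (fun n => -ν n * z.2 n, fun n => ν n * z.1 n + (ν n)⁻¹ * partials V z.1 n)

variable {ν : ι → ℝ} {V : (ι → ℝ) → ℝ}

lemma contDiff_partials [DecidableEq ι] (hV : ContDiff ℝ ∞ V) : ContDiff ℝ 1 (partials V) := by
  have h : ContDiff ℝ 1 (fderiv ℝ V) := hV.fderiv_right (m := 1) (by norm_cast)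
  rw [contDiff_pi]
  intro n
  exact h.clm_apply contDiff_const

lemma contDiff_hamField [DecidableEq ι] (hV : ContDiff ℝ ∞ V) : ContDiff ℝ 1 (hamField ν V) := by
  have h := contDiff_partials hV
  have h2 : ∀ n, ContDiff ℝ 1 fun z : (ι → ℝ) × (ι → ℝ) => partials V z.1 n := fun n =>
    (contDiff_pi.1 h n).comp contDiff_fst
  unfold hamField
  refine ContDiff.prodMk (contDiff_pi.2 fun n => ?_) (contDiff_pi.2 fun n => ?_)
  · fun_prop
  · have := h2 n
    fun_prop

lemma contDiff_ham (hV : ContDiff ℝ ∞ V) : ContDiff ℝ ∞ (ham ν V) := by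
  unfold ham
  have : ContDiff ℝ ∞ fun z : (ι → ℝ) × (ι → ℝ) => V z.1 := hV.comp contDiff_fst
  fun_prop

/-- The Hamiltonian is constant along curves tangent to a multiple of its vector field. -/
lemma hasDerivAt_ham_comp [DecidableEq ι] (hν : ∀ n, ν n ≠ 0) (hV : ContDiff ℝ ∞ V)
    {y : ℝ → (ι → ℝ) × (ι → ℝ)} {s t : ℝ} (hy : HasDerivAt y (s • hamField ν V (y t)) t) :
    HasDerivAt (fun r => ham ν V (y r)) 0 t := by
  have h1 : ∀ n, HasDerivAt (fun r => (y r).1 n) (s * (-ν n * (y t).2 n)) t :=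
    hasDerivAt_pi.1 hy.fst
  have h2 : ∀ n, HasDerivAt (fun r => (y r).2 n)
      (s * (ν n * (y t).1 n + (ν n)⁻¹ * partials V (y t).1 n)) t :=
    hasDerivAt_pi.1 hy.snd
  have h3 : HasDerivAt (fun r => V (y r).1)
      (fderiv ℝ V (y t).1 (s • (hamField ν V (y t)).1)) t :=
    (hV.differentiable (by simp) _).hasFDerivAt.comp_hasDerivAt t hy.fst
  have h4 := (HasDerivAt.fun_sum (u := Finset.univ) fun n _ =>
    (((h1 n).pow 2).add ((h2 n).pow 2)).const_mul (ν n ^ 2 / 2)).add h3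
  refine h4.congr_deriv ?_
  have h5 : fderiv ℝ V (y t).1 (s • (hamField ν V (y t)).1)
      = ∑ n, s * (-ν n * (y t).2 n) * partials V (y t).1 n := by
    have e : s • (hamField ν V (y t)).1 = ∑ n, (s * (-ν n * (y t).2 n)) • Pi.single n (1 : ℝ) := by
      ext k
      simp [hamField, Finset.sum_apply, Pi.single_apply]
    rw [e, map_sum]
    simp [partials]
  rw [h5, ← Finset.sum_add_distrib]
  -- In each mode the two quadratic contributions cancel, and so do the two contributions of `∂V`:
  -- the factor `(ν n)⁻¹` in the field matches the weight `ν n ^ 2` in the energy.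
  refine Finset.sum_eq_zero fun n _ => ?_
  have := hν n
  field_simp
  ring

/-- Since `V ≥ 0`, the quadratic part alone is at most `R`. Bounded sublevel sets are what makes the
flow global. -/
lemma exists_norm_le_of_ham_le (hν : ∀ n, 0 < ν n) (hV0 : ∀ a, 0 ≤ V a) (R : ℝ) :
    ∃ r : ℝ, 0 ≤ r ∧ ∀ z, ham ν V z ≤ R → ‖z‖ ≤ r := by
  refine ⟨∑ n, Real.sqrt (2 * R) / ν n, Finset.sum_nonneg fun n _ => by have := hν n; positivity,
    fun z hz => ?_⟩
  have hterm : ∀ n, ν n ^ 2 / 2 * (z.1 n ^ 2 + z.2 n ^ 2) ≤ R := fun n => by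
    refine le_trans ?_ hz
    unfold ham
    have := Finset.single_le_sum (f := fun n => ν n ^ 2 / 2 * (z.1 n ^ 2 + z.2 n ^ 2))
      (fun k _ => by positivity) (Finset.mem_univ n)
    linarith [hV0 z.1]
  have hle : ∀ n, Real.sqrt (2 * R) / ν n ≤ ∑ n, Real.sqrt (2 * R) / ν n := fun n =>
    Finset.single_le_sum (f := fun n => Real.sqrt (2 * R) / ν n)
      (fun k _ => by have := hν k; positivity) (Finset.mem_univ n)
  have hnn : 0 ≤ ∑ n, Real.sqrt (2 * R) / ν n :=
    Finset.sum_nonneg fun n _ => by have := hν n; positivity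
  refine norm_prod_le_iff.2 ⟨(pi_norm_le_iff_of_nonneg hnn).2 fun n => ?_,
    (pi_norm_le_iff_of_nonneg hnn).2 fun n => ?_⟩ <;>
  · refine le_trans ?_ (hle n)
    rw [le_div_iff₀ (hν n), Real.norm_eq_abs]
    refine Real.le_sqrt_of_sq_le ?_
    rw [mul_pow, sq_abs]
    nlinarith [hterm n, sq_nonneg (ν n * z.1 n), sq_nonneg (ν n * z.2 n)]

/-- The Hamiltonian system has global solutions, along which the Hamiltonian is constant. -/
lemma exists_hamCurve [DecidableEq ι] (hν : ∀ n, 0 < ν n) (hV : ContDiff ℝ ∞ V)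
    (hV0 : ∀ a, 0 ≤ V a) (z : (ι → ℝ) × (ι → ℝ)) :
    ∃ y : ℝ → (ι → ℝ) × (ι → ℝ), y 0 = z ∧ (∀ t, HasDerivAt y (hamField ν V (y t)) t) ∧
      ∀ t, ham ν V (y t) = ham ν V z := by
  set R := ham ν V z
  -- This cut-off is 1 on `{ham ≤ R}` and 0 on `{ham ≥ R + 1}`, so the cut-off field has compact
  -- support and global curves. Its curves still conserve the energy, hence remain where `θ = 1` and
  -- solve the original system.
  set θ : (ι → ℝ) × (ι → ℝ) → ℝ := fun x => Real.smoothTransition (R + 1 - ham ν V x) with hθ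
  have hham := contDiff_ham (ν := ν) hV
  have hθs : ContDiff ℝ 1 θ :=
    (Real.smoothTransition.contDiff.comp (contDiff_const.sub hham)).of_le (by norm_cast)
  have hf : ContDiff ℝ 1 fun x => θ x • hamField ν V x := hθs.smul (contDiff_hamField hV)
  have hcs : HasCompactSupport fun x => θ x • hamField ν V x := by
    obtain ⟨r, -, hr⟩ := exists_norm_le_of_ham_le hν hV0 (R + 1)
    refine HasCompactSupport.of_support_subset_isCompact (isCompact_closedBall 0 r) fun x hx => ?_
    rw [mem_closedBall_zero_iff]
    refine hr x ?_
    by_contra! hlt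
    refine hx ?_
    simp only [hθ]
    rw [Real.smoothTransition.zero_of_nonpos (by linarith), zero_smul]
  obtain ⟨y, hy0, hy⟩ := exists_integralCurve_of_hasCompactSupport hf hcs z
  have hder := fun t => hasDerivAt_ham_comp (fun n => (hν n).ne') hV (hy t)
  have hconst : ∀ t, ham ν V (y t) = R := fun t => by
    have := is_const_of_deriv_eq_zero (fun t => (hder t).differentiableAt)
      (fun t => (hder t).deriv) t 0
    rw [this, hy0]
  refine ⟨y, hy0, fun t => ?_, hconst⟩
  have h := hy t
  simp only [hθ, hconst t] at h
  rwa [Real.smoothTransition.one_of_one_le (by linarith), one_smul] at h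

end

/-! ### The symplectic Euler scheme -/

section

variable {E : Type*} [NormedAddCommGroup E] [NormedSpace ℝ E]

/-- One step of the symplectic Euler scheme for `a' = F(b)`, `b' = G(a)`. -/
def eulerStep (F G : E → E) (h : ℝ) (z : E × E) : E × E :=
  (z.1 + h • F z.2, z.2 + h • G (z.1 + h • F z.2))

variable {F G : E → E} {K : ℝ≥0}

lemma norm_eulerStep_sub_le (hF : LipschitzWith K F) (hG : LipschitzWith K G) {h : ℝ}
    (hh : |h| ≤ 1) (z w : E × E) :
    ‖eulerStep F G h z - eulerStep F G h w‖ ≤ (1 + K * (1 + K) * |h|) * ‖z - w‖ := by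
  have hK : (0 : ℝ) ≤ K := K.2
  have h0 := abs_nonneg h
  set d := ‖z - w‖ with hd
  have hd0 : 0 ≤ d := norm_nonneg _
  have h1 : ‖z.1 - w.1‖ ≤ d := norm_fst_le (z - w)
  have h2 : ‖z.2 - w.2‖ ≤ d := norm_snd_le (z - w)
  have e1 : ‖(eulerStep F G h z).1 - (eulerStep F G h w).1‖ ≤ (1 + K * |h|) * d := by
    have : (eulerStep F G h z).1 - (eulerStep F G h w).1
        = (z.1 - w.1) + h • (F z.2 - F w.2) := by
      simp only [eulerStep, smul_sub]; abel
    rw [this]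
    refine (norm_add_le _ _).trans ?_
    rw [norm_smul, Real.norm_eq_abs]
    have := (hF.norm_sub_le z.2 w.2).trans (mul_le_mul_of_nonneg_left h2 hK)
    nlinarith [mul_le_mul_of_nonneg_left this h0]
  have e2 : ‖(eulerStep F G h z).2 - (eulerStep F G h w).2‖ ≤ (1 + K * (1 + K) * |h|) * d := by
    have : (eulerStep F G h z).2 - (eulerStep F G h w).2
        = (z.2 - w.2) + h • (G (eulerStep F G h z).1 - G (eulerStep F G h w).1) := by
      simp only [eulerStep, smul_sub]; abel
    rw [this]
    refine (norm_add_le _ _).trans ?_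
    rw [norm_smul, Real.norm_eq_abs]
    have h3 := (hG.norm_sub_le (eulerStep F G h z).1 (eulerStep F G h w).1).trans
      (mul_le_mul_of_nonneg_left e1 hK)
    have h4 : K * ((1 + K * |h|) * d) ≤ K * ((1 + K) * d) := by
      gcongr
      nlinarith
    nlinarith [mul_le_mul_of_nonneg_left (h3.trans h4) h0]
  refine norm_prod_le_iff.2 ⟨e1.trans ?_, e2⟩
  gcongr
  nlinarith

/-- Consistency of the scheme: the Euler step and the exact curve both differ from the tangent step
`y t + h X (y t)` by at most `K B h²`. -/
lemma norm_eulerStep_sub_curve_le (hF : LipschitzWith K F) (hG : LipschitzWith K G) {B : ℝ}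
    {y : ℝ → E × E} (hy : ∀ t, HasDerivAt y (F (y t).2, G (y t).1) t)
    (hB : ∀ t, ‖(F (y t).2, G (y t).1)‖ ≤ B) (t h : ℝ) :
    ‖eulerStep F G h (y t) - y (t + h)‖ ≤ 2 * K * B * h ^ 2 := by
  have hK : (0 : ℝ) ≤ K := K.2
  have hB0 : 0 ≤ B := (norm_nonneg _).trans (hB 0)
  set X : E × E → E × E := fun z => (F z.2, G z.1) with hX
  have hXL : ∀ z w, ‖X z - X w‖ ≤ K * ‖z - w‖ := fun z w => by
    refine norm_prod_le_iff.2 ⟨?_, ?_⟩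
    · exact (hF.norm_sub_le _ _).trans (mul_le_mul_of_nonneg_left (norm_snd_le (z - w)) hK)
    · exact (hG.norm_sub_le _ _).trans (mul_le_mul_of_nonneg_left (norm_fst_le (z - w)) hK)
  have hyL : ∀ r s, ‖y r - y s‖ ≤ B * |r - s| := fun r s => by
    have := convex_univ.norm_image_sub_le_of_norm_hasDerivWithin_le (f := y) (C := B)
      (fun x _ => (hy x).hasDerivWithinAt) (fun x _ => hB x) (mem_univ s) (mem_univ r)
    simpa using this
  have h1 : ‖y (t + h) - y t - h • X (y t)‖ ≤ K * B * h ^ 2 := by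
    have hd : ∀ s ∈ uIcc 0 h, HasDerivWithinAt (fun s => y (t + s) - s • X (y t))
        (X (y (t + s)) - X (y t)) (uIcc 0 h) s := fun s _ => by
      have a1 := (hy (t + s)).scomp s ((hasDerivAt_id s).const_add t)
      have a2 := (hasDerivAt_id s).smul_const (X (y t))
      have a3 := (a1.sub a2).hasDerivWithinAt (s := uIcc 0 h)
      simp only [one_smul] at a3
      exact a3
    have hb : ∀ s ∈ uIcc 0 h, ‖X (y (t + s)) - X (y t)‖ ≤ K * (B * |h|) := fun s hs => by
      refine (hXL _ _).trans (mul_le_mul_of_nonneg_left ((hyL _ _).trans ?_) hK)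
      rw [add_sub_cancel_left]
      have := abs_sub_left_of_mem_uIcc hs
      simp only [sub_zero] at this
      gcongr
    have := (convex_uIcc 0 h).norm_image_sub_le_of_norm_hasDerivWithin_le hd hb
      left_mem_uIcc right_mem_uIcc
    simp only [add_zero, zero_smul, sub_zero, Real.norm_eq_abs] at this
    rw [sub_right_comm]
    refine this.trans (le_of_eq ?_)
    rw [← sq_abs h]; ring
  have h2 : ‖eulerStep F G h (y t) - y t - h • X (y t)‖ ≤ K * B * h ^ 2 := by
    have e : eulerStep F G h (y t) - y t - h • X (y t)
        = (0, h • (G ((y t).1 + h • F (y t).2) - G (y t).1)) := by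
      ext <;> simp [eulerStep, hX, smul_sub]
    rw [e]
    refine norm_prod_le_iff.2 ⟨by simpa using by positivity, ?_⟩
    rw [norm_smul, Real.norm_eq_abs]
    have a1 := hG.norm_sub_le ((y t).1 + h • F (y t).2) (y t).1
    rw [add_sub_cancel_left, norm_smul, Real.norm_eq_abs] at a1
    have a2 : ‖F (y t).2‖ ≤ B := (norm_fst_le (X (y t))).trans (hB t)
    rw [← sq_abs h]
    calc |h| * _ ≤ |h| * (K * (|h| * B)) := by gcongr; exact a1.trans (by gcongr)
      _ = _ := by ring
  calc _ = ‖(eulerStep F G h (y t) - y t - h • X (y t)) - (y (t + h) - y t - h • X (y t))‖ := by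
        congr 1; abel
    _ ≤ _ := (norm_sub_le _ _).trans (add_le_add h2 h1)
    _ = _ := by ring

/-- Each step adds an error of order `h²`, and earlier errors are amplified by at most the Lipschitz
constant of one step. -/
lemma norm_eulerStep_iterate_sub_le (hF : LipschitzWith K F) (hG : LipschitzWith K G) {B : ℝ}
    {y : ℝ → E × E} (hy : ∀ t, HasDerivAt y (F (y t).2, G (y t).1) t)
    (hB : ∀ t, ‖(F (y t).2, G (y t).1)‖ ≤ B) {h : ℝ} (hh : |h| ≤ 1) (j : ℕ) :
    ‖(eulerStep F G h)^[j] (y 0) - y (j * h)‖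
      ≤ j * (2 * K * B * h ^ 2) * (1 + K * (1 + K) * |h|) ^ j := by
  have hK : (0 : ℝ) ≤ K := K.2
  have hB0 : 0 ≤ B := (norm_nonneg _).trans (hB 0)
  induction j with
  | zero => simp
  | succ j ih =>
    rw [Function.iterate_succ_apply']
    have e : ((j + 1 : ℕ) : ℝ) * h = j * h + h := by push_cast; ring
    rw [e]
    set A := 2 * K * B * h ^ 2 with hA
    set q := 1 + K * (1 + K) * |h| with hq
    have hA0 : 0 ≤ A := by positivity
    have hq1 : 1 ≤ q := by
      have : 0 ≤ K * (1 + K) * |h| := by positivity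
      linarith
    have h1 := norm_eulerStep_sub_le hF hG hh ((eulerStep F G h)^[j] (y 0)) (y (j * h))
    have h2 := norm_eulerStep_sub_curve_le hF hG hy hB (j * h) h
    calc _ ≤ _ := norm_sub_le_norm_sub_add_norm_sub _ (eulerStep F G h (y (j * h))) _
      _ ≤ q * (j * A * q ^ j) + A * q ^ (j + 1) := by
        refine add_le_add (h1.trans (by gcongr)) (h2.trans ?_)
        exact le_mul_of_one_le_right hA0 (one_le_pow₀ hq1)
      _ = _ := by push_cast; ring

/-- Convergence of the symplectic Euler scheme for Lipschitz vector fields. -/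
lemma tendsto_eulerStep_iterate (hF : LipschitzWith K F) (hG : LipschitzWith K G) {B : ℝ}
    {y : ℝ → E × E} (hy : ∀ t, HasDerivAt y (F (y t).2, G (y t).1) t)
    (hB : ∀ t, ‖(F (y t).2, G (y t).1)‖ ≤ B) (T : ℝ) :
    Tendsto (fun k : ℕ => (eulerStep F G (T / k))^[k] (y 0)) atTop (nhds (y T)) := by
  have hK : (0 : ℝ) ≤ K := K.2
  have hB0 : 0 ≤ B := (norm_nonneg _).trans (hB 0)
  rw [tendsto_iff_norm_sub_tendsto_zero]
  have hlim : Tendsto (fun k : ℕ => 2 * K * B * T ^ 2 * Real.exp (K * (1 + K) * |T|) / (k : ℝ))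
      atTop (nhds 0) := tendsto_const_div_atTop_nhds_zero_nat _
  refine squeeze_zero' (Eventually.of_forall fun _ => norm_nonneg _) ?_ hlim
  filter_upwards [eventually_ge_atTop (⌈|T|⌉₊ + 1)] with k hk
  have hk' : |T| + 1 ≤ k := (add_le_add_left (Nat.le_ceil |T|) 1).trans (by exact_mod_cast hk)
  have hk0 : (0 : ℝ) < k := by linarith [abs_nonneg T]
  have hh : |T / k| ≤ 1 := by
    rw [abs_div, abs_of_pos hk0, div_le_one hk0]; linarith
  have h1 := norm_eulerStep_iterate_sub_le hF hG hy hB hh k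
  rw [mul_div_cancel₀ _ hk0.ne'] at h1
  refine h1.trans ?_
  have h2 : (1 + K * (1 + K) * |T / k|) ^ k ≤ Real.exp (K * (1 + K) * |T|) := by
    have := Real.add_one_le_exp (K * (1 + K) * |T / k|)
    rw [add_comm] at this
    refine (pow_le_pow_left₀ (by positivity) this k).trans (le_of_eq ?_)
    rw [← Real.exp_nat_mul, abs_div, abs_of_pos hk0]
    congr 1
    field_simp
  calc _ ≤ k * (2 * K * B * (T / k) ^ 2) * Real.exp (K * (1 + K) * |T|) := by gcongr
    _ = _ := by field_simp

end

/-! ### Volume preservation of the scheme. -/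

section

variable {ι : Type*} [Fintype ι] {F G : (ι → ℝ) → (ι → ℝ)}

/-- Each half-step translates one variable by a function of the other. It is a shear, preserved by
Fubini and translation invariance, without any Jacobian. -/
lemma measurePreserving_eulerStep (hF : Measurable F) (hG : Measurable G) (h : ℝ) :
    MeasurePreserving (eulerStep F G h) volume volume := by
  have hshear : ∀ {Q : (ι → ℝ) → (ι → ℝ)}, Measurable Q →
      MeasurePreserving (fun z : (ι → ℝ) × (ι → ℝ) => (z.1, z.2 + h • Q z.1)) volume volume := by
    intro Q hQ
    exact (MeasurePreserving.id volume).skew_product (g := fun a b => b + h • Q a)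
      (by unfold Function.uncurry; fun_prop)
      (ae_of_all _ fun a => map_add_right_eq_self volume (h • Q a))
  have hswap : MeasurePreserving (Prod.swap : (ι → ℝ) × (ι → ℝ) → _) volume volume :=
    Measure.measurePreserving_swap
  exact (hshear hG).comp (hswap.comp ((hshear hF).comp hswap))

lemma measurePreserving_iterate_eulerStep (hF : Measurable F) (hG : Measurable G) (h : ℝ) (k : ℕ) :
    MeasurePreserving ((eulerStep F G h)^[k]) volume volume :=
  (measurePreserving_eulerStep hF hG h).iterate k

end

/-! ### The Hamiltonian flow does not increase the Gibbs measure -/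

section

variable {ι : Type*} [Fintype ι] [DecidableEq ι] {ν : ι → ℝ} {V : (ι → ℝ) → ℝ}

/-- `φ z t` is the value at time `t` of a solution of the Hamiltonian system that starts
at `z` and along which the Hamiltonian is constant. -/
structure IsHamFlow (ν : ι → ℝ) (V : (ι → ℝ) → ℝ)
    (φ : (ι → ℝ) × (ι → ℝ) → ℝ → (ι → ℝ) × (ι → ℝ)) : Prop where
  init : ∀ z, φ z 0 = z
  deriv : ∀ z t, HasDerivAt (φ z) (hamField ν V (φ z t)) t
  ham_eq : ∀ z t, ham ν V (φ z t) = ham ν V z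

lemma exists_isHamFlow (hν : ∀ n, 0 < ν n) (hV : ContDiff ℝ ∞ V) (hV0 : ∀ a, 0 ≤ V a) :
    ∃ φ, IsHamFlow ν V φ := by
  choose φ h0 h1 h2 using exists_hamCurve hν hV hV0
  exact ⟨φ, h0, h1, h2⟩

variable {φ : (ι → ℝ) × (ι → ℝ) → ℝ → (ι → ℝ) × (ι → ℝ)}

/-- On each sublevel set of the Hamiltonian, the flow is a limit of maps that preserve volume. -/
lemma IsHamFlow.exists_approx (hφ : IsHamFlow ν V φ) (hν : ∀ n, 0 < ν n) (hV : ContDiff ℝ ∞ V)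
    (hV0 : ∀ a, 0 ≤ V a) (R T : ℝ) :
    ∃ Φ : ℕ → (ι → ℝ) × (ι → ℝ) → (ι → ℝ) × (ι → ℝ),
      (∀ k, MeasurePreserving (Φ k) volume volume) ∧
      ∀ z, ham ν V z ≤ R → Tendsto (fun k => Φ k z) atTop (nhds (φ z T)) := by
  obtain ⟨r, hr0, hr⟩ := exists_norm_le_of_ham_le hν hV0 R
  set F : (ι → ℝ) → ι → ℝ := fun b n => -ν n * b n with hF
  set G : (ι → ℝ) → ι → ℝ := fun a n => ν n * a n + (ν n)⁻¹ * partials V a n with hG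
  have hFs : ContDiff ℝ 1 F := by unfold F; fun_prop
  have hGs : ContDiff ℝ 1 G := by
    have h : ∀ n, ContDiff ℝ 1 fun a => partials V a n := contDiff_pi.1 (contDiff_partials hV)
    refine contDiff_pi.2 fun n => ?_
    have := h n
    unfold G
    fun_prop
  have hcomp : IsCompact (Metric.closedBall (0 : ι → ℝ) r) := isCompact_closedBall 0 r
  obtain ⟨K₁, hK₁⟩ := hFs.locallyLipschitz.locallyLipschitzOn.exists_lipschitzOnWith_of_compact hcomp
  obtain ⟨K₂, hK₂⟩ := hGs.locallyLipschitz.locallyLipschitzOn.exists_lipschitzOnWith_of_compact hcomp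
  -- The fields are Lipschitz only on bounded sets. Global Lipschitz extensions agree with them on a
  -- ball that contains the exact trajectory; the Euler iterates may leave this ball, but they
  -- preserve volume for any measurable fields.
  obtain ⟨F', hF', hFF'⟩ := hK₁.extend_pi
  obtain ⟨G', hG', hGG'⟩ := hK₂.extend_pi
  refine ⟨fun k => (eulerStep F' G' (T / k))^[k], fun k => measurePreserving_iterate_eulerStep
    hF'.continuous.measurable hG'.continuous.measurable _ _, fun z hz => ?_⟩
  have hb : ∀ t, ‖φ z t‖ ≤ r := fun t => hr _ ((hφ.ham_eq z t).le.trans hz)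
  have hfield : ∀ t, hamField ν V (φ z t) = (F' (φ z t).2, G' (φ z t).1) := fun t => by
    rw [← hFF' (mem_closedBall_zero_iff.2 ((norm_snd_le _).trans (hb t))),
      ← hGG' (mem_closedBall_zero_iff.2 ((norm_fst_le _).trans (hb t)))]
    rfl
  obtain ⟨B, hB⟩ := (isCompact_closedBall (0 : (ι → ℝ) × (ι → ℝ)) r).exists_bound_of_continuousOn
    (contDiff_hamField (ν := ν) hV).continuous.continuousOn
  have := tendsto_eulerStep_iterate (hF'.weaken (le_max_left K₁ K₂))
    (hG'.weaken (le_max_right K₁ K₂)) (y := φ z) (B := B)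
    (fun t => by rw [← hfield]; exact hφ.deriv z t)
    (fun t => by rw [← hfield]; exact hB _ (mem_closedBall_zero_iff.2 (hb t))) T
  rwa [hφ.init] at this

/-- The flow comes from a pointwise choice of curves. It is measurable as a limit of Euler iterates
on each sublevel set of the energy, and these sets exhaust the space. -/
lemma IsHamFlow.measurable (hφ : IsHamFlow ν V φ) (hν : ∀ n, 0 < ν n) (hV : ContDiff ℝ ∞ V)
    (hV0 : ∀ a, 0 ≤ V a) (T : ℝ) : Measurable fun z => φ z T := by
  classical
  have hham : Measurable (ham ν V) := (contDiff_ham hV).continuous.measurable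
  have hset : ∀ R, MeasurableSet {z | ham ν V z ≤ R} := fun R =>
    measurableSet_le hham measurable_const
  have h1 : ∀ R : ℝ, Measurable fun z => if ham ν V z ≤ R then φ z T else z := fun R => by
    obtain ⟨Φ, hΦ, hlim⟩ := hφ.exists_approx hν hV hV0 R T
    refine measurable_of_tendsto_metrizable (f := fun k z => if ham ν V z ≤ R then Φ k z else z)
      (fun k => (hΦ k).measurable.ite (hset R) measurable_id) (tendsto_pi_nhds.2 fun z => ?_)
    by_cases hz : ham ν V z ≤ R
    · simpa [hz] using hlim z hz
    · simp [hz]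
  refine measurable_of_tendsto_metrizable (fun k : ℕ => h1 k) (tendsto_pi_nhds.2 fun z => ?_)
  refine tendsto_const_nhds.congr' ?_
  filter_upwards [eventually_ge_atTop ⌈ham ν V z⌉₊] with k hk
  rw [if_pos ((Nat.le_ceil _).trans (by exact_mod_cast hk))]

lemma lowerSemicontinuous_indicator_of_isOpen {X : Type*} [TopologicalSpace X] {U : Set X}
    (hU : IsOpen U) {f : X → ℝ≥0∞} (hf : Continuous f) :
    LowerSemicontinuous (U.indicator f) := by
  intro x y hy
  by_cases hx : x ∈ U
  · rw [indicator_of_mem hx] at hy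
    filter_upwards [hU.mem_nhds hx, (hf.tendsto x).eventually (lt_mem_nhds hy)] with z hz hzy
    rwa [indicator_of_mem hz]
  · rw [indicator_of_notMem hx] at hy
    exact absurd hy not_lt_zero

/-- A one-sided Liouville theorem. For open `A` the truncated density is lower semicontinuous, so
its value at the limit is at most the limes inferior of its values along the volume-preserving
approximations, and Fatou gives the inequality. Energy conservation allows restriction to `{ham <
R}`; then `R → ∞` by monotone convergence. -/
lemma IsHamFlow.lintegral_comp_le (hφ : IsHamFlow ν V φ) (hν : ∀ n, 0 < ν n)
    (hV : ContDiff ℝ ∞ V) (hV0 : ∀ a, 0 ≤ V a) (T β : ℝ) {A : Set ((ι → ℝ) × (ι → ℝ))}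
    (hA : IsOpen A) :
    ∫⁻ z, A.indicator (fun z => ENNReal.ofReal (Real.exp (-(β * ham ν V z)))) (φ z T)
      ≤ ∫⁻ z, A.indicator (fun z => ENNReal.ofReal (Real.exp (-(β * ham ν V z)))) z := by
  have hham : Continuous (ham ν V) := (contDiff_ham hV).continuous
  set f : (ι → ℝ) × (ι → ℝ) → ℝ≥0∞ := fun z => ENNReal.ofReal (Real.exp (-(β * ham ν V z)))
  have hf : Continuous f := ENNReal.continuous_ofReal.comp (by fun_prop)
  have hopen : ∀ R, IsOpen (A ∩ {z | ham ν V z < R}) := fun R =>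
    hA.inter (isOpen_lt hham continuous_const)
  have hlsc : ∀ R, LowerSemicontinuous ((A ∩ {z | ham ν V z < R}).indicator f) := fun R =>
    lowerSemicontinuous_indicator_of_isOpen (hopen R) hf
  have h1 : ∀ R : ℝ, ∫⁻ z, (A ∩ {z | ham ν V z < R}).indicator f (φ z T)
      ≤ ∫⁻ z, A.indicator f z := fun R => by
    obtain ⟨Φ, hΦ, hlim⟩ := hφ.exists_approx hν hV hV0 R T
    set g := (A ∩ {z | ham ν V z < R}).indicator f
    have hg : Measurable g := (hlsc R).measurable
    have hpt : ∀ z, g (φ z T) ≤ liminf (fun k => g (Φ k z)) atTop := fun z => by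
      by_cases hz : ham ν V z < R
      · refine le_of_forall_lt fun y hy => ?_
        obtain ⟨y', hyy', hy'⟩ := exists_between hy
        have := (hlim z hz.le).eventually (hlsc R (φ z T) y' hy')
        exact hyy'.trans_le (le_liminf_of_le (by isBoundedDefault) (this.mono fun k hk => hk.le))
      · have : φ z T ∉ A ∩ {z | ham ν V z < R} := fun h => hz (by
          have := h.2
          rwa [mem_ofPred_eq, hφ.ham_eq] at this)
        simp only [g, indicator_of_notMem this, zero_le]
    calc ∫⁻ z, g (φ z T) ≤ ∫⁻ z, liminf (fun k => g (Φ k z)) atTop := lintegral_mono hpt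
      _ ≤ liminf (fun k => ∫⁻ z, g (Φ k z)) atTop :=
        lintegral_liminf_le fun k => hg.comp (hΦ k).measurable
      _ = ∫⁻ z, g z := by
        simp only [(hΦ _).lintegral_comp hg, liminf_const]
      _ ≤ _ := lintegral_mono fun z => indicator_le_indicator_of_subset inter_subset_left
        (fun _ => zero_le) z
  have hmeas := hφ.measurable hν hV hV0 T
  have hmono : Monotone fun (k : ℕ) z => (A ∩ {z | ham ν V z < k}).indicator f (φ z T) :=
    fun j k hjk z => indicator_le_indicator_of_subset (inter_subset_inter_right _ fun w
      (hw : ham ν V w < j) => hw.trans_le (by exact_mod_cast hjk)) (fun _ => zero_le) _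
  have hsup : ∀ z, A.indicator f (φ z T)
      = ⨆ k : ℕ, (A ∩ {z | ham ν V z < k}).indicator f (φ z T) := fun z => by
    refine le_antisymm ?_ (iSup_le fun k =>
      indicator_le_indicator_of_subset inter_subset_left (fun _ => zero_le) _)
    obtain ⟨k, hk⟩ := exists_nat_gt (ham ν V (φ z T))
    refine le_iSup_of_le k ?_
    by_cases hz : φ z T ∈ A
    · rw [indicator_of_mem hz,
        indicator_of_mem (show φ z T ∈ A ∩ {z | ham ν V z < k} from ⟨hz, hk⟩)]
    · simp [indicator_of_notMem hz]
  simp only [hsup]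
  have hmeas' : ∀ k : ℕ, Measurable fun z => (A ∩ {z | ham ν V z < k}).indicator f (φ z T) :=
    fun k => (hlsc k).measurable.comp hmeas
  rw [lintegral_iSup hmeas' hmono]
  exact iSup_le fun k => h1 k

end

/-! ### The law of finitely many Gaussian coefficients -/

lemma pi_gaussianReal {ι : Type*} [Fintype ι] {w : ι → ℝ≥0} (hw : ∀ n, w n ≠ 0) :
    Measure.pi (fun n => gaussianReal 0 (w n))
      = volume.withDensity fun x => ENNReal.ofReal (∏ n, gaussianPDFReal 0 (w n) (x n)) := by
  refine Measure.pi_eq fun s hs => ?_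
  have h0 : ∀ n y, 0 ≤ (s n).indicator (gaussianPDFReal 0 (w n)) y := fun n y =>
    indicator_nonneg (fun y _ => gaussianPDFReal_nonneg 0 (w n) y) y
  have h1 : ∀ x, (univ.pi s).indicator
      (fun x => ENNReal.ofReal (∏ n, gaussianPDFReal 0 (w n) (x n))) x
      = ENNReal.ofReal (∏ n, (s n).indicator (gaussianPDFReal 0 (w n)) (x n)) := fun x => by
    by_cases hx : x ∈ univ.pi s
    · rw [indicator_of_mem hx]
      congr 1
      exact Finset.prod_congr rfl fun n _ => (indicator_of_mem (hx n (mem_univ n)) _).symm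
    · rw [indicator_of_notMem hx]
      simp only [mem_univ_pi, not_forall] at hx
      obtain ⟨n, hn⟩ := hx
      rw [Finset.prod_eq_zero (Finset.mem_univ n) (indicator_of_notMem hn _), ENNReal.ofReal_zero]
  have hint : ∀ n, Integrable ((s n).indicator (gaussianPDFReal 0 (w n))) := fun n =>
    (integrable_gaussianPDFReal 0 (w n)).indicator (hs n)
  rw [withDensity_apply _ (.univ_pi hs), ← lintegral_indicator (.univ_pi hs)]
  simp only [h1]
  have hI : Integrable (fun x : ι → ℝ => ∏ n, (s n).indicator (gaussianPDFReal 0 (w n)) (x n)) := by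
    rw [volume_pi]
    exact Integrable.fintype_prod hint
  rw [← ofReal_integral_eq_lintegral_ofReal hI
    (ae_of_all _ fun x => Finset.prod_nonneg fun n _ => h0 n _),
    integral_fintype_prod_volume_eq_prod (fun n => (s n).indicator (gaussianPDFReal 0 (w n))),
    ENNReal.ofReal_prod_of_nonneg fun n _ => integral_nonneg (h0 n)]
  refine Finset.prod_congr rfl fun n _ => ?_
  rw [gaussianReal_apply_eq_integral _ (hw n), integral_indicator (hs n)]

section

variable {Ω : Type*} [MeasurableSpace Ω] {P : Measure Ω} {v : ℝ≥0}
  {g : ℕ → Ω → ℂ}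

/-- The first `N` coefficients of the random series, in real coordinates. -/
def lowCoord (g : ℕ → Ω → ℂ) (N : ℕ) (w : Ω) : (Fin N → ℝ) × (Fin N → ℝ) :=
  (fun n => (g n w).re / freq n, fun n => (g n w).im / freq n)

/-- The quadratic part of the Hamiltonian. -/
def quadForm (N : ℕ) (z : (Fin N → ℝ) × (Fin N → ℝ)) : ℝ :=
  ∑ n : Fin N, freq n ^ 2 / 2 * (z.1 n ^ 2 + z.2 n ^ 2)

lemma IsGaussianSeq.measurable_lowCoord (hg : IsGaussianSeq P v g) (N : ℕ) :
    Measurable (lowCoord g N) := by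
  have := hg.meas
  unfold lowCoord
  fun_prop

variable [IsProbabilityMeasure P]

/-- Each real coordinate has variance `v / freq n ^ 2`, so the law of the low modes is the Gibbs
measure of the quadratic energy at inverse temperature `1 / v`. -/
lemma IsGaussianSeq.exists_map_lowCoord (hg : IsGaussianSeq P v g) (hv : 0 < v) (N : ℕ) :
    ∃ Z : ℝ, 0 < Z ∧ P.map (lowCoord g N) = volume.withDensity fun z =>
      ENNReal.ofReal (Z * Real.exp (-((v : ℝ)⁻¹ * quadForm N z))) := by
  have hgm := hg.meas
  set w : Fin N → ℝ≥0 := fun n => v / NNReal.mk (freq n ^ 2) (sq_nonneg _) with hwdef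
  have hw : ∀ n, w n ≠ 0 := fun n => by
    refine div_ne_zero hv.ne' fun h => ?_
    have : freq n ^ 2 = 0 := congrArg NNReal.toReal h
    exact (pow_pos (freq_pos n) 2).ne' this
  have h1 : P.map (fun x (n : Fin N) => ((g n x).re / freq n, (g n x).im / freq n))
      = Measure.pi fun n => (gaussianReal 0 (w n)).prod (gaussianReal 0 (w n)) := by
    have hm : ∀ n : Fin N, Measurable fun x => ((g n x).re / freq n, (g n x).im / freq n) :=
      fun n => by fun_prop
    have hind : iIndepFun (fun (n : Fin N) x => ((g n x).re / freq n, (g n x).im / freq n)) P :=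
      (hg.indep.precomp Fin.val_injective).comp
        (fun (n : Fin N) z => (z.re / freq n, z.im / freq n)) (fun n => by fun_prop)
    rw [(iIndepFun_iff_map_fun_eq_pi_map fun n => (hm n).aemeasurable).1 hind]
    congr 1; ext1 n
    have e : (fun x => ((g n x).re / freq n, (g n x).im / freq n))
        = (fun z : ℂ => (z.re / freq n, z.im / freq n)) ∘ g n := rfl
    rw [e, ← Measure.map_map (by fun_prop) (hgm n), hg.law, complexGaussian,
      Measure.map_map (by fun_prop) (by fun_prop)]
    have e2 : ((fun z : ℂ => (z.re / freq n, z.im / freq n)) ∘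
        fun z : ℝ × ℝ => (z.1 : ℂ) + z.2 * Complex.I)
        = Prod.map (fun r => r / freq n) (fun r => r / freq n) := by
      ext z <;> simp
    rw [e2, ← Measure.map_prod_map _ _ (by fun_prop) (by fun_prop), gaussianReal_map_div_const,
      zero_div]
  have h2 : P.map (lowCoord g N) = (Measure.pi fun n => gaussianReal 0 (w n)).prod
      (Measure.pi fun n => gaussianReal 0 (w n)) := by
    have hmp := measurePreserving_arrowProdEquivProdArrow ℝ ℝ (Fin N)
      (fun n => gaussianReal 0 (w n)) (fun n => gaussianReal 0 (w n))
    rw [← hmp.map_eq, ← h1, Measure.map_map hmp.measurable (by fun_prop)]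
    rfl
  set c : ℝ := ∏ n : Fin N, (Real.sqrt (2 * Real.pi * w n))⁻¹ with hc
  have hwpos : ∀ n, (0 : ℝ) < w n := fun n => by
    have := hw n
    positivity
  have hcpos : 0 < c := Finset.prod_pos fun n _ => by
    have := hwpos n
    have := Real.pi_pos
    positivity
  have hdens : ∀ x : Fin N → ℝ, ∏ n, gaussianPDFReal 0 (w n) (x n)
      = c * Real.exp (∑ n : Fin N, -((v : ℝ)⁻¹ * (freq n ^ 2 / 2 * x n ^ 2))) := fun x => by
    rw [hc, Real.exp_sum, ← Finset.prod_mul_distrib]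
    refine Finset.prod_congr rfl fun n _ => ?_
    rw [gaussianPDFReal]
    congr 2
    have hf := (freq_pos n).ne'
    have hv' : (v : ℝ) ≠ 0 := by exact_mod_cast hv.ne'
    simp only [hwdef, NNReal.coe_div, sub_zero]
    change -x n ^ 2 / (2 * ((v : ℝ) / freq n ^ 2)) = _
    field_simp
  refine ⟨c * c, by positivity, ?_⟩
  rw [h2, pi_gaussianReal hw, prod_withDensity]
  · congr 1; ext z
    rw [← ENNReal.ofReal_mul (Finset.prod_nonneg fun n _ => gaussianPDFReal_nonneg _ _ _),
      hdens, hdens, mul_mul_mul_comm, ← Real.exp_add, ← Finset.sum_add_distrib]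
    congr 3
    rw [quadForm, Finset.mul_sum, ← Finset.sum_neg_distrib]
    refine Finset.sum_congr rfl fun n _ => ?_
    ring
  all_goals
    refine ENNReal.measurable_ofReal.comp (Finset.measurable_prod _ fun n _ => ?_)
    exact (measurable_gaussianPDFReal 0 (w n)).comp (measurable_pi_apply n)

/-- The Gaussian measure of the data that the Hamiltonian flow sends into a set `A`. -/
lemma IsGaussianSeq.measure_hamFlow_mem_le (hg : IsGaussianSeq P v g) (hv : 0 < v) {N : ℕ}
    {V : (Fin N → ℝ) → ℝ} (hV : ContDiff ℝ ∞ V) (hV0 : ∀ a, 0 ≤ V a)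
    {φ : (Fin N → ℝ) × (Fin N → ℝ) → ℝ → (Fin N → ℝ) × (Fin N → ℝ)}
    (hφ : IsHamFlow (fun n : Fin N => freq n) V φ) (T K : ℝ)
    (A : Set ((Fin N → ℝ) × (Fin N → ℝ))) :
    P {w | φ (lowCoord g N w) T ∈ A ∧ V (lowCoord g N w).1 ≤ K}
      ≤ ENNReal.ofReal (Real.exp (K / v)) * P.map (lowCoord g N) A := by
  obtain ⟨Z, hZ, hmap⟩ := hg.exists_map_lowCoord hv N
  have hL := hg.measurable_lowCoord N
  have hprob : IsProbabilityMeasure (P.map (lowCoord g N)) :=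
    Measure.isProbabilityMeasure_map hL.aemeasurable
  have hfreq : ∀ n : Fin N, 0 < freq n := fun n => freq_pos n
  have hφm := hφ.measurable hfreq hV hV0 T
  have hVm : Measurable fun z : (Fin N → ℝ) × (Fin N → ℝ) => V z.1 :=
    hV.continuous.measurable.comp measurable_fst
  have hv' : (0 : ℝ) < v := hv
  have hq : Measurable (quadForm N) := by unfold quadForm; fun_prop
  have hqm : Measurable fun z => ENNReal.ofReal (Z * Real.exp (-((v : ℝ)⁻¹ * quadForm N z))) := by
    fun_prop
  set f : (Fin N → ℝ) × (Fin N → ℝ) → ℝ≥0∞ :=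
    fun z => ENNReal.ofReal (Real.exp (-((v : ℝ)⁻¹ * ham (fun n : Fin N => freq n) V z)))
  have hham : ∀ z, ham (fun n : Fin N => freq n) V z = quadForm N z + V z.1 := fun z => rfl
  have hopen : ∀ U, IsOpen U → P {w | φ (lowCoord g N w) T ∈ U ∧ V (lowCoord g N w).1 ≤ K}
      ≤ ENNReal.ofReal (Real.exp (K / v)) * P.map (lowCoord g N) U := fun U hU => by
    set s := {z | φ z T ∈ U ∧ V z.1 ≤ K}
    have hs : MeasurableSet s := (hφm hU.measurableSet).inter (hVm measurableSet_Iic)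
    have e1 : P {w | φ (lowCoord g N w) T ∈ U ∧ V (lowCoord g N w).1 ≤ K}
        = P.map (lowCoord g N) s := (Measure.map_apply hL hs).symm
    rw [e1, hmap, withDensity_apply _ hs, withDensity_apply _ hU.measurableSet,
      ← lintegral_indicator hs, ← lintegral_indicator hU.measurableSet]
    -- On `s` the bound `V ≤ K` gives Gaussian density at most `exp (K / v)` times Gibbs density,
    -- and the latter is constant along the flow. The return to the Gaussian density in `hA2` uses
    -- `V ≥ 0`.
    have hA1 : ∀ z, s.indicator
        (fun z => ENNReal.ofReal (Z * Real.exp (-((v : ℝ)⁻¹ * quadForm N z)))) z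
        ≤ ENNReal.ofReal (Real.exp (K / v) * Z) * U.indicator f (φ z T) := fun z => by
      by_cases hz : z ∈ s
      · rw [indicator_of_mem hz, indicator_of_mem hz.1, ← ENNReal.ofReal_mul (by positivity),
          hφ.ham_eq, hham]
        refine ENNReal.ofReal_le_ofReal ?_
        rw [mul_comm (Real.exp _) Z, mul_assoc, ← Real.exp_add]
        have : (v : ℝ)⁻¹ * V z.1 ≤ K / v := by
          rw [div_eq_inv_mul]; exact mul_le_mul_of_nonneg_left hz.2 (by positivity)
        gcongr
        linarith
      · rw [indicator_of_notMem hz]; exact zero_le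
    have hA2 : ∀ z, ENNReal.ofReal (Real.exp (K / v) * Z) * U.indicator f z
        ≤ ENNReal.ofReal (Real.exp (K / v)) * U.indicator
          (fun z => ENNReal.ofReal (Z * Real.exp (-((v : ℝ)⁻¹ * quadForm N z)))) z := fun z => by
      by_cases hz : z ∈ U
      · rw [indicator_of_mem hz, indicator_of_mem hz, ← ENNReal.ofReal_mul (by positivity),
          ← ENNReal.ofReal_mul (by positivity), hham]
        refine ENNReal.ofReal_le_ofReal ?_
        rw [mul_assoc]
        gcongr
        linarith [hV0 z.1]
      · rw [indicator_of_notMem hz, mul_zero]; exact zero_le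
    calc _ ≤ ∫⁻ z, ENNReal.ofReal (Real.exp (K / v) * Z) * U.indicator f (φ z T) :=
          lintegral_mono hA1
      _ = ENNReal.ofReal (Real.exp (K / v) * Z) * ∫⁻ z, U.indicator f (φ z T) :=
          lintegral_const_mul' _ _ ENNReal.ofReal_ne_top
      _ ≤ ENNReal.ofReal (Real.exp (K / v) * Z) * ∫⁻ z, U.indicator f z := by
          exact mul_le_mul_right (hφ.lintegral_comp_le hfreq hV hV0 T _ hU) _
      _ = ∫⁻ z, ENNReal.ofReal (Real.exp (K / v) * Z) * U.indicator f z :=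
          (lintegral_const_mul' _ _ ENNReal.ofReal_ne_top).symm
      _ ≤ _ := lintegral_mono hA2
      _ = _ := lintegral_const_mul' _ _ ENNReal.ofReal_ne_top
  have h0 : ENNReal.ofReal (Real.exp (K / v)) ≠ 0 := by simpa using Real.exp_pos _
  rw [← ENNReal.div_le_iff' h0 ENNReal.ofReal_ne_top]
  -- Outer regularity extends the bound from open sets to arbitrary ones.
  rw [A.measure_eq_iInf_isOpen]
  refine le_iInf fun U => le_iInf fun hAU => le_iInf fun hU => ?_
  rw [ENNReal.div_le_iff' h0 ENNReal.ofReal_ne_top]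
  have hsub : {w | φ (lowCoord g N w) T ∈ A ∧ V (lowCoord g N w).1 ≤ K}
      ⊆ {w | φ (lowCoord g N w) T ∈ U ∧ V (lowCoord g N w).1 ≤ K} := fun w hw => ⟨hAU hw.1, hw.2⟩
  exact (measure_mono hsub).trans (hopen U hU)

end

section

open HSob

/-! ### The potential of the truncated equation -/

/-- The function `S_N (∑ a_n e_n)` on the ball, for real coefficients. -/
def realSum (χ : ℝ → ℝ) (N : ℕ) (a : Fin N → ℝ) (x : EuclideanSpace ℝ (Fin 3)) : ℝ :=
  ∑ n : Fin N, symbolSN χ N n * a n * eigenfun n x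

/-- The potential energy `¼ ∫ (S_N (∑ a_n e_n))⁴`, divided by the square of the norm of the
eigenfunctions. -/
def potential (χ : ℝ → ℝ) (N : ℕ) (a : Fin N → ℝ) : ℝ :=
  (4 * eigenNormSq)⁻¹ * ∫ x, realSum χ N a x ^ 4 ∂ballMeasure

variable {χ : ℝ → ℝ} {N : ℕ}

lemma measurable_realSum (a : Fin N → ℝ) : Measurable (realSum χ N a) := by
  have := measurable_eigenfun
  unfold realSum
  fun_prop

lemma exists_abs_realSum_le (a : Fin N → ℝ) : ∃ C, ∀ x, |realSum χ N a x| ≤ C := by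
  refine ⟨∑ n : Fin N, |symbolSN χ N n * a n| * (freq n / Real.sqrt Real.pi), fun x => ?_⟩
  refine (Finset.abs_sum_le_sum_abs _ _).trans (Finset.sum_le_sum fun n _ => ?_)
  rw [abs_mul]
  exact mul_le_mul_of_nonneg_left (abs_eigenfun_le n x) (abs_nonneg _)

lemma integrable_realSum_pow_mul (a : Fin N → ℝ) (n j k : ℕ) :
    Integrable (fun x => realSum χ N a x ^ j * eigenfun n x ^ k) ballMeasure := by
  obtain ⟨C, hC⟩ := exists_abs_realSum_le (χ := χ) a
  have h1 := measurable_realSum (χ := χ) a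
  have h2 := measurable_eigenfun n
  refine Integrable.of_bound (C := C ^ j * (freq n / Real.sqrt Real.pi) ^ k) (by fun_prop)
    (ae_of_all _ fun x => ?_)
  rw [Real.norm_eq_abs, abs_mul, abs_pow, abs_pow]
  have h0 : 0 ≤ C := (abs_nonneg _).trans (hC x)
  gcongr
  · exact hC x
  · exact abs_eigenfun_le n x

lemma potential_nonneg (a : Fin N → ℝ) : 0 ≤ potential χ N a := by
  have := eigenNormSq_pos
  exact mul_nonneg (by positivity) (integral_nonneg fun x => by positivity)

/-- Expanding the fourth power makes the potential a homogeneous polynomial of degree 4 in the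
coefficients. -/
lemma contDiff_potential : ContDiff ℝ ∞ (potential χ N) := by
  have h : ∀ a : Fin N → ℝ, ∫ x, realSum χ N a x ^ 4 ∂ballMeasure
      = ∑ q : Fin 4 → Fin N, (∏ i, a (q i)) *
        ∫ x, ∏ i, symbolSN χ N (q i) * eigenfun (q i) x ∂ballMeasure := fun a => by
    have e : ∀ x, realSum χ N a x ^ 4 = ∑ q : Fin 4 → Fin N, (∏ i, a (q i)) *
        ∏ i, symbolSN χ N (q i) * eigenfun (q i) x := fun x => by
      rw [realSum, Fintype.sum_pow]
      refine Finset.sum_congr rfl fun q _ => ?_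
      rw [← Finset.prod_mul_distrib]
      exact Finset.prod_congr rfl fun i _ => by ring
    simp only [e]
    rw [integral_finsetSum]
    · simp only [integral_const_mul]
    · intro q _
      refine Integrable.const_mul (Integrable.of_bound
        (C := ∏ i, |symbolSN χ N (q i)| * (freq (q i) / Real.sqrt Real.pi)) ?_ (ae_of_all _ fun x => ?_)) _
      · have := measurable_eigenfun
        fun_prop
      · rw [Real.norm_eq_abs, Finset.abs_prod]
        refine Finset.prod_le_prod (fun i _ => abs_nonneg _) fun i _ => ?_
        rw [abs_mul]
        exact mul_le_mul_of_nonneg_left (abs_eigenfun_le _ x) (abs_nonneg _)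
  have e : potential χ N = fun a => (4 * eigenNormSq)⁻¹ * ∑ q : Fin 4 → Fin N, (∏ i, a (q i)) *
        ∫ x, ∏ i, symbolSN χ N (q i) * eigenfun (q i) x ∂ballMeasure := by
    ext a; rw [potential, h]
  rw [e]
  refine contDiff_const.mul (ContDiff.sum fun q _ => ContDiff.mul ?_ contDiff_const)
  exact contDiff_prod fun i _ => contDiff_apply ℝ ℝ (q i)

lemma realSum_add_smul_single (a : Fin N → ℝ) (n : Fin N) (s : ℝ)
    (x : EuclideanSpace ℝ (Fin 3)) : realSum χ N (a + s • Pi.single n 1) x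
      = realSum χ N a x + s * (symbolSN χ N n * eigenfun n x) := by
  have e : ∀ k : Fin N, symbolSN χ N k * (a + s • (Pi.single n 1 : Fin N → ℝ)) k * eigenfun k x
      = symbolSN χ N k * a k * eigenfun k x
        + if k = n then s * (symbolSN χ N n * eigenfun n x) else 0 := fun k => by
    by_cases h : k = n
    · subst h; simp; ring
    · simp [h]
  unfold realSum
  simp only [e]
  rw [Finset.sum_add_distrib, Finset.sum_ite_eq' Finset.univ n]
  simp

/-- Along a coordinate direction the potential is a quartic polynomial in `s`, and its derivative at
0 is the linear coefficient. The factor `(4 * eigenNormSq)⁻¹` makes it the coefficient of the cube,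
so the truncated nonlinearity is exactly `freq⁻¹` times the gradient of the potential. -/
lemma partials_potential (a : Fin N → ℝ) (n : Fin N) :
    partials (potential χ N) a n
      = symbolSN χ N n * radialCoeff n fun x => realSum χ N a x ^ 3 := by
  have h1 : HasDerivAt (fun s : ℝ => potential χ N (a + s • Pi.single n 1))
      (partials (potential χ N) a n) 0 :=
    ((contDiff_potential (χ := χ)).differentiable (by simp) a).hasFDerivAt.hasLineDerivAt _
  set b := symbolSN χ N n
  set I : ℕ → ℕ → ℝ := fun j k => ∫ x, realSum χ N a x ^ j * eigenfun n x ^ k ∂ballMeasure with hI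
  have h2 : ∀ s : ℝ, potential χ N (a + s • Pi.single n 1) = (4 * eigenNormSq)⁻¹ *
      (I 4 0 + s * (4 * b * I 3 1) + s ^ 2 * (6 * b ^ 2 * I 2 2) + s ^ 3 * (4 * b ^ 3 * I 1 3)
        + s ^ 4 * (b ^ 4 * I 0 4)) := fun s => by
    rw [potential]
    congr 1
    have hi := fun j k => integrable_realSum_pow_mul (χ := χ) a n j k
    have e : ∀ x, realSum χ N (a + s • Pi.single n 1) x ^ 4
        = realSum χ N a x ^ 4 * eigenfun n x ^ 0
          + s * (4 * b) * (realSum χ N a x ^ 3 * eigenfun n x ^ 1)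
          + s ^ 2 * (6 * b ^ 2) * (realSum χ N a x ^ 2 * eigenfun n x ^ 2)
          + s ^ 3 * (4 * b ^ 3) * (realSum χ N a x ^ 1 * eigenfun n x ^ 3)
          + s ^ 4 * b ^ 4 * (realSum χ N a x ^ 0 * eigenfun n x ^ 4) := fun x => by
      rw [realSum_add_smul_single]; ring
    simp only [e]
    rw [integral_add, integral_add, integral_add, integral_add]
    · simp only [integral_const_mul, hI]
      ring
    all_goals
      repeat' first
        | exact hi _ _
        | exact (hi _ _).const_mul _
        | apply Integrable.add
  have h3 : HasDerivAt (fun s : ℝ => (4 * eigenNormSq)⁻¹ *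
      (I 4 0 + s * (4 * b * I 3 1) + s ^ 2 * (6 * b ^ 2 * I 2 2) + s ^ 3 * (4 * b ^ 3 * I 1 3)
        + s ^ 4 * (b ^ 4 * I 0 4))) ((4 * eigenNormSq)⁻¹ * (4 * b * I 3 1)) 0 := by
    have := ((((((hasDerivAt_id (0 : ℝ)).mul_const (4 * b * I 3 1)).const_add (I 4 0)).add
      (((hasDerivAt_id (0 : ℝ)).pow 2).mul_const (6 * b ^ 2 * I 2 2))).add
      (((hasDerivAt_id (0 : ℝ)).pow 3).mul_const (4 * b ^ 3 * I 1 3))).add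
      (((hasDerivAt_id (0 : ℝ)).pow 4).mul_const (b ^ 4 * I 0 4))).const_mul (4 * eigenNormSq)⁻¹
    refine this.congr_deriv ?_
    simp
  simp only [h2] at h1
  rw [h1.unique h3, radialCoeff, integral_eigenfun_sq]
  have := eigenNormSq_pos
  simp only [hI, pow_one]
  field_simp

/-! ### The truncated flow in coordinates -/

/-- Index `n` stands for eigenfunction number `n + 1`, so `n ≥ N` puts the argument of `χ` strictly
above 1. -/
lemma symbolSN_eq_zero (hχ : IsCutoff χ) {n : ℕ} (hN : 1 ≤ N) (h : N ≤ n) : symbolSN χ N n = 0 := by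
  unfold symbolSN
  refine image_eq_zero_of_notMem_tsupport fun hmem => ?_
  have h1 := (hχ.support hmem).2
  have hN' : (0 : ℝ) < N := by exact_mod_cast hN
  rw [div_le_one (by positivity)] at h1
  have h2 : (N : ℝ) ≤ n := by exact_mod_cast h
  nlinarith

variable {σ : ℝ}

/-- The sequence with real and imaginary parts `z`, extended by `0`. -/
def toSeq (N : ℕ) (z : (Fin N → ℝ) × (Fin N → ℝ)) (n : ℕ) : ℂ :=
  if h : n < N then (z.1 ⟨n, h⟩ : ℂ) + z.2 ⟨n, h⟩ * Complex.I else 0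

lemma mem_sobolevSeq_of_eventually_zero {c : ℕ → ℂ} (h : ∀ n, N ≤ n → c n = 0) :
    c ∈ sobolevSeq σ := by
  refine memℓp_gen (summable_of_hasFiniteSupport ((finite_Iio N).subset fun n hn => ?_))
  by_contra! hle
  refine hn ?_
  simp [h n (not_lt.1 hle)]

/-- The element of `H^σ` with coefficients `c_n` for `n < N`, and `0` beyond. -/
def finElt (σ : ℝ) (N : ℕ) (c : ℕ → ℂ) : HSob σ :=
  ⟨lowPart N c, mem_sobolevSeq_of_eventually_zero (N := N) fun n hn => by
    simp [lowPart, not_lt.2 hn]⟩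

lemma coeff_finElt (c : ℕ → ℂ) : coeff (finElt σ N c) = lowPart N c := rfl

lemma coeff_ext {u w : HSob σ} (h : ∀ n, coeff u n = coeff w n) : u = w :=
  coeff_injective (funext h)

/-- The first `N` coefficients of an element of `H^σ`, in real coordinates. -/
def lowData (N : ℕ) (u : HSob σ) : (Fin N → ℝ) × (Fin N → ℝ) :=
  (fun n => (coeff u n).re, fun n => (coeff u n).im)

/-- The trajectory of the truncated flow built from a Hamiltonian flow `φ` on the first `N`
coefficients. -/
def truncTraj (φ : (Fin N → ℝ) × (Fin N → ℝ) → ℝ → (Fin N → ℝ) × (Fin N → ℝ)) (u₀ : HSob σ)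
    (t : ℝ) : HSob σ :=
  S t u₀ + finElt σ N (toSeq N (φ (lowData N u₀) t) - coeff (S t u₀))

variable {φ : (Fin N → ℝ) × (Fin N → ℝ) → ℝ → (Fin N → ℝ) × (Fin N → ℝ)}

lemma lowPart_coeff_truncTraj (u₀ : HSob σ) (t : ℝ) :
    lowPart N (coeff (truncTraj φ u₀ t)) = toSeq N (φ (lowData N u₀) t) := by
  ext n
  rw [truncTraj, map_add, coeff_finElt]
  simp only [lowPart, Pi.add_apply, Pi.sub_apply, toSeq]
  split_ifs <;> simp

lemma highPart_coeff_truncTraj (u₀ : HSob σ) (t : ℝ) :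
    highPart N (coeff (truncTraj φ u₀ t)) = highPart N (coeff (S t u₀)) := by
  ext n
  rw [truncTraj, map_add, coeff_finElt]
  simp only [lowPart, highPart, Pi.add_apply, Pi.sub_apply]
  split_ifs <;> simp

lemma truncRe_eq_realSum (c : ℕ → ℂ) :
    truncRe χ N c = realSum χ N fun n => (c n).re := by
  ext x
  rw [truncRe, realSum, Finset.sum_range]

/-- For low modes the real and imaginary parts of the equation are the two halves of the Hamiltonian
system; for high modes both `v` and the nonlinearity vanish. -/
lemma isTruncFlow_truncTraj (hχ : IsCutoff χ) (hN : 1 ≤ N)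
    (hφ : IsHamFlow (fun n : Fin N => freq n) (potential χ N) φ) (u₀ : HSob σ) :
    IsTruncFlow χ N u₀ (truncTraj φ u₀) := by
  refine ⟨fun t => finElt σ N (toSeq N (φ (lowData N u₀) t) - coeff (S t u₀)), ?_, fun t => rfl⟩
  have hexp : ∀ n (t : ℝ), HasDerivAt (fun s : ℝ => Complex.exp (Complex.I * freq n * s) * coeff u₀ n)
      (Complex.I * freq n * (Complex.exp (Complex.I * freq n * t) * coeff u₀ n)) t := fun n t => by
    have h1 : HasDerivAt (fun s : ℝ => Complex.I * freq n * (s : ℂ)) (Complex.I * freq n) t := by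
      simpa using (Complex.ofRealCLM.hasDerivAt (x := t)).const_mul (Complex.I * freq n)
    exact (h1.cexp.mul_const _).congr_deriv (by ring)
  have hre : ∀ t (n : Fin N), HasDerivAt (fun s => (φ (lowData N u₀) s).1 n)
      (-freq n * (φ (lowData N u₀) t).2 n) t := fun t n =>
    hasDerivAt_pi.1 (hφ.deriv (lowData N u₀) t).fst n
  have him : ∀ t (n : Fin N), HasDerivAt (fun s => (φ (lowData N u₀) s).2 n)
      (freq n * (φ (lowData N u₀) t).1 n
        + (freq n)⁻¹ * partials (potential χ N) (φ (lowData N u₀) t).1 n) t := fun t n =>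
    hasDerivAt_pi.1 (hφ.deriv (lowData N u₀) t).snd n
  have hder : ∀ n (h : n < N) t, HasDerivAt
      (fun s => coeff (finElt σ N (toSeq N (φ (lowData N u₀) s) - coeff (S s u₀))) n)
      (((-freq n * (φ (lowData N u₀) t).2 ⟨n, h⟩ : ℝ) : ℂ)
        + ((freq n * (φ (lowData N u₀) t).1 ⟨n, h⟩
          + (freq n)⁻¹ * partials (potential χ N) (φ (lowData N u₀) t).1 ⟨n, h⟩ : ℝ) : ℂ) * Complex.I
        - Complex.I * freq n * (Complex.exp (Complex.I * freq n * t) * coeff u₀ n)) t := by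
    intro n h t
    have e : ∀ s, coeff (finElt σ N (toSeq N (φ (lowData N u₀) s) - coeff (S s u₀))) n
        = ((φ (lowData N u₀) s).1 ⟨n, h⟩ : ℂ) + ((φ (lowData N u₀) s).2 ⟨n, h⟩ : ℂ) * Complex.I
          - Complex.exp (Complex.I * freq n * s) * coeff u₀ n := fun s => by
      rw [coeff_finElt]
      simp only [lowPart, Pi.sub_apply, toSeq, h, if_true, dif_pos, coeff_S]
    simp only [e]
    exact ((hre t ⟨n, h⟩).ofReal_comp.add ((him t ⟨n, h⟩).ofReal_comp.mul_const Complex.I)).sub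
      (hexp n t)
  have hzero : ∀ n, ¬ n < N → ∀ s,
      coeff (finElt σ N (toSeq N (φ (lowData N u₀) s) - coeff (S s u₀))) n = 0 := fun n h s => by
    rw [coeff_finElt]; simp [lowPart, h]
  refine ⟨?_, fun t n hn => hzero n (not_lt.2 hn) t, fun n => ?_, fun t n => ?_⟩
  · refine coeff_ext fun n => ?_
    rw [coeff_finElt, hφ.init]
    simp only [lowPart, Pi.sub_apply, toSeq, map_zero, Pi.zero_apply, coeff_S, lowData]
    split_ifs with h
    · simp
    · rfl
  · by_cases h : n < N
    · exact fun t => (hder n h t).differentiableAt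
    · simp only [hzero n h]
      exact differentiable_const _
  · by_cases h : n < N
    · have hrs : truncRe χ N (coeff (truncTraj φ u₀ t))
          = realSum χ N (φ (lowData N u₀) t).1 := by
        rw [truncRe_eq_realSum]
        congr 1; ext k
        have := congrFun (lowPart_coeff_truncTraj (φ := φ) u₀ t) k
        simp only [lowPart, k.2, if_true, toSeq, dif_pos] at this
        rw [this]; simp
      have hnl : truncNonlin χ N (coeff (truncTraj φ u₀ t)) n
          = (freq n)⁻¹ * partials (potential χ N) (φ (lowData N u₀) t).1 ⟨n, h⟩ := by
        rw [truncNonlin, partials_potential, hrs]; ring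
      change _ + _ + ((truncNonlin χ N (coeff (truncTraj φ u₀ t)) n : ℝ) : ℂ) = 0
      rw [(hder n h t).deriv, hnl, coeff_finElt]
      simp only [lowPart, h, if_true, Pi.sub_apply, toSeq, dif_pos, coeff_S]
      push_cast
      linear_combination ((freq n : ℂ) * (φ (lowData N u₀) t).1 ⟨n, h⟩
          + (freq n : ℂ)⁻¹ * partials (potential χ N) (φ (lowData N u₀) t).1 ⟨n, h⟩
          - freq n * (Complex.exp (Complex.I * freq n * t) * coeff u₀ n)) * Complex.I_mul_I
    · simp only [hzero n h]
      rw [truncNonlin, symbolSN_eq_zero hχ hN (not_lt.1 h)]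
      simp

end

section

open HSob

/-! ### Tail bounds for the truncated flow -/

lemma measurable_sobolevSq (σ : ℝ) : Measurable (sobolevSq σ) := by
  unfold sobolevSq
  fun_prop

lemma measurableSet_goodSeq (σ p D : ℝ) : MeasurableSet (goodSeq σ p D) :=
  (measurableSet_le (Measurable.liminf fun M => measurable_freeInt p M) measurable_const).inter
    (measurableSet_le (measurable_sobolevSq σ) measurable_const)

lemma measurable_toSeq (N : ℕ) : Measurable (toSeq N) := by
  refine measurable_pi_lambda _ fun n => ?_
  unfold toSeq
  split_ifs with h
  · fun_prop
  · exact measurable_const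

/-- The coefficients of an element of `H^σ`, normalised to be standard under `μ`. -/
def normCoeff (σ : ℝ) (n : ℕ) (u : HSob σ) : ℂ := freq n * coeff u n

variable {σ : ℝ} {N : ℕ}

lemma normCoeff_div_freq (n : ℕ) (u : HSob σ) : normCoeff σ n u / freq n = coeff u n :=
  mul_div_cancel_left₀ _ (Complex.ofReal_ne_zero.2 (freq_pos n).ne')

lemma lowCoord_normCoeff (u : HSob σ) : lowCoord (normCoeff σ) N u = lowData N u := by
  unfold lowCoord lowData
  refine Prod.ext (funext fun n => ?_) (funext fun n => ?_)
  · exact (Complex.div_ofReal_re _ _).symm.trans (congrArg Complex.re (normCoeff_div_freq _ u))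
  · exact (Complex.div_ofReal_im _ _).symm.trans (congrArg Complex.im (normCoeff_div_freq _ u))

lemma toSeq_lowData (u : HSob σ) : toSeq N (lowData N u) = lowPart N (coeff u) := by
  ext n
  simp only [toSeq, lowData, lowPart]
  split_ifs <;> simp [Complex.re_add_im]

lemma IsCutoff.exists_abs_le {χ : ℝ → ℝ} (hχ : IsCutoff χ) : ∃ B, 0 < B ∧ ∀ x, |χ x| ≤ B := by
  have hc : HasCompactSupport χ := isCompact_Icc.of_isClosed_subset (isClosed_tsupport χ) hχ.support
  obtain ⟨B, hB⟩ := hc.exists_bound_of_continuous hχ.smooth.continuous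
  exact ⟨max B 1, by positivity, fun x => (hB x).trans (le_max_left _ _)⟩

lemma IsGaussianSeq.exists_potential_tail {Ω : Type*} [MeasurableSpace Ω] {P : Measure Ω}
    [IsProbabilityMeasure P] {v : ℝ≥0} {g : ℕ → Ω → ℂ} (hg : IsGaussianSeq P v g) {χ : ℝ → ℝ}
    (hχ : IsCutoff χ) :
    ∃ C : ℝ≥0∞, C ≠ ⊤ ∧ ∀ (N : ℕ) (K : ℝ), 0 < K →
      P {w | K < potential χ N (lowCoord g N w).1} ≤ C / ENNReal.ofReal K ^ (3 / 2 : ℝ) := by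
  obtain ⟨B, hB, hχB⟩ := hχ.exists_abs_le
  -- `5/8` lies between `1/2` and `3/4`, the threshold for `L⁴`. The sixth moment of the sum (`m =
  -- 3`) then gives the exponent `6 / 4 = 3 / 2` in `K`.
  obtain ⟨C, hC, hCs⟩ := exists_sum_sq_eigenfun_div_freq_le (a := 5 / 8) (by norm_num) (by norm_num)
  have hmeas := measurable_eigenfun
  have hgm := hg.meas
  have hκ := eigenNormSq_pos
  set I := ∫⁻ x, ENNReal.ofReal (B * C * ‖x‖ ^ (-(5 / 8 : ℝ))) ^ (4 : ℝ) ∂ballMeasure with hI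
  have hIt : I ≠ ⊤ :=
    (lintegral_weight_lt_top (by positivity) (by norm_num) (by norm_num)).ne
  set C' := ENNReal.ofReal (momentConst v 3) * I ^ (((2 * 3 : ℕ) : ℝ) / 4)
  have hC' : C' ≠ ⊤ :=
    ENNReal.mul_ne_top ENNReal.ofReal_ne_top (ENNReal.rpow_ne_top_of_nonneg (by positivity) hIt)
  have hκt : ENNReal.ofReal (4 * eigenNormSq) ^ (3 / 2 : ℝ) ≠ 0 :=
    (ENNReal.rpow_pos (ENNReal.ofReal_pos.2 (by positivity)) ENNReal.ofReal_ne_top).ne'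
  refine ⟨C' / ENNReal.ofReal (4 * eigenNormSq) ^ (3 / 2 : ℝ), ENNReal.div_ne_top hC' hκt,
    fun N K hK => ?_⟩
  set J : Ω → ℝ≥0∞ := fun w => ∫⁻ x, ‖∑ n ∈ Finset.range N,
    ((symbolSN χ N n * (eigenfun n x / freq n) : ℝ) : ℂ) * g n w‖ₑ ^ (4 : ℝ) ∂ballMeasure with hJ
  have hmom : ∫⁻ w, J w ^ (((2 * 3 : ℕ) : ℝ) / 4) ∂P ≤ C' := by
    refine hg.lintegral_lintegral_rpow_le (κ := ballMeasure) (Finset.range N)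
      (z := fun n x => ((symbolSN χ N n * (eigenfun n x / freq n) : ℝ) : ℂ)) (fun n => by fun_prop)
      (W := fun x => B * C * ‖x‖ ^ (-(5 / 8 : ℝ))) (by fun_prop) ?_ ?_ (by norm_num) (by norm_num)
    · filter_upwards [ae_ballMeasure_ne_zero] with x hx
      have := norm_pos_iff.2 hx
      positivity
    · filter_upwards [ae_ballMeasure_ne_zero] with x hx
      have h1 := hCs (Finset.range N) x hx
      calc ∑ n ∈ Finset.range N, ‖((symbolSN χ N n * (eigenfun n x / freq n) : ℝ) : ℂ)‖ ^ 2
          ≤ ∑ n ∈ Finset.range N, B ^ 2 * (eigenfun n x / freq n) ^ 2 := by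
            refine Finset.sum_le_sum fun n _ => ?_
            rw [Complex.norm_real, norm_mul, mul_pow, Real.norm_eq_abs, Real.norm_eq_abs, sq_abs
              (eigenfun n x / freq n)]
            gcongr
            exact hχB _
        _ = B ^ 2 * ∑ n ∈ Finset.range N, (eigenfun n x / freq n) ^ 2 := by rw [Finset.mul_sum]
        _ ≤ B ^ 2 * (C * ‖x‖ ^ (-(5 / 8 : ℝ))) ^ 2 := by gcongr
        _ = _ := by ring
  have hJm : Measurable J := by
    refine Measurable.lintegral_prod_right' (f := fun q : Ω × EuclideanSpace ℝ (Fin 3) =>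
      ‖∑ n ∈ Finset.range N,
        ((symbolSN χ N n * (eigenfun n q.2 / freq n) : ℝ) : ℂ) * g n q.1‖ₑ ^ (4 : ℝ)) ?_
    fun_prop
  have hsub : {w | K < potential χ N (lowCoord g N w).1}
      ⊆ {w | ENNReal.ofReal (4 * eigenNormSq * K) ^ (3 / 2 : ℝ)
        ≤ J w ^ (((2 * 3 : ℕ) : ℝ) / 4)} := fun w hw => by
    have e : ((2 * 3 : ℕ) : ℝ) / 4 = 3 / 2 := by norm_num
    rw [mem_ofPred_eq, e]
    refine ENNReal.rpow_le_rpow ?_ (by norm_num)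
    have hint : Integrable (fun x => realSum χ N (lowCoord g N w).1 x ^ 4) ballMeasure := by
      simpa using integrable_realSum_pow_mul (χ := χ) (lowCoord g N w).1 0 4 0
    have h1 : 4 * eigenNormSq * K ≤ ∫ x, realSum χ N (lowCoord g N w).1 x ^ 4 ∂ballMeasure := by
      have h2 : K < potential χ N (lowCoord g N w).1 := hw
      rw [potential, inv_mul_eq_div, lt_div_iff₀ (by positivity)] at h2
      linarith
    refine (ENNReal.ofReal_le_ofReal h1).trans ?_
    rw [ofReal_integral_eq_lintegral_ofReal hint (ae_of_all _ fun x => by positivity)]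
    refine lintegral_mono fun x => ?_
    have e2 : realSum χ N (lowCoord g N w).1 x = (∑ n ∈ Finset.range N,
        ((symbolSN χ N n * (eigenfun n x / freq n) : ℝ) : ℂ) * g n w).re := by
      rw [realSum, Complex.re_sum, Finset.sum_range]
      refine Finset.sum_congr rfl fun n _ => ?_
      rw [Complex.re_ofReal_mul]
      simp only [lowCoord]
      ring
    simp only [e2]
    rw [← ofReal_norm, ENNReal.ofReal_rpow_of_nonneg (norm_nonneg _) (by norm_num),
      show (4 : ℝ) = ((4 : ℕ) : ℝ) by norm_num, Real.rpow_natCast, ← Even.pow_abs (by decide)]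
    exact ENNReal.ofReal_le_ofReal (pow_le_pow_left₀ (abs_nonneg _) (Complex.abs_re_le_norm _) 4)
  have hpos : 0 < 4 * eigenNormSq * K := by positivity
  refine (measure_mono hsub).trans ?_
  refine (meas_ge_le_lintegral_div (hJm.pow_const _).aemeasurable
    (ENNReal.rpow_pos (ENNReal.ofReal_pos.2 hpos) ENNReal.ofReal_ne_top).ne'
    (ENNReal.rpow_ne_top_of_nonneg (by norm_num) ENNReal.ofReal_ne_top)).trans ?_
  refine (ENNReal.div_le_div_right hmom _).trans (le_of_eq ?_)
  rw [ENNReal.ofReal_mul (by positivity), ENNReal.mul_rpow_of_nonneg _ _ (by norm_num),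
    ENNReal.div_eq_inv_mul, ENNReal.div_eq_inv_mul, ENNReal.div_eq_inv_mul, ENNReal.mul_inv
    (Or.inl hκt) (Or.inl (ENNReal.rpow_ne_top_of_nonneg (by norm_num) ENNReal.ofReal_ne_top)),
    mul_comm (ENNReal.ofReal (4 * eigenNormSq) ^ (3 / 2 : ℝ))⁻¹, mul_assoc]

/-! ### The probability of leaving `A(D)` at one time. -/

section

variable {μ : Measure (HSob σ)} [IsProbabilityMeasure μ] {v : ℝ≥0}

/-- The probability that the truncated flow leaves `A(D)` at time `T`, with data of potential
energy at most `K`. -/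
lemma measure_truncTraj_notMem_le {χ : ℝ → ℝ} (hg : IsGaussianSeq μ v (normCoeff σ)) (hv : 0 < v)
    {p : ℝ} (hp : 1 ≤ p) {m : ℕ} {C : ℝ≥0∞}
    (hC : ∀ θ : ℕ → ℂ, (∀ n, ‖θ n‖ ≤ 1) → ∀ D : ℝ, 0 < D →
      μ {u | (fun n => θ n * normCoeff σ n u / freq n) ∉ goodSeq σ p D}
        ≤ C / ENNReal.ofReal D ^ (2 * m))
    {φ : (Fin N → ℝ) × (Fin N → ℝ) → ℝ → (Fin N → ℝ) × (Fin N → ℝ)}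
    (hφ : IsHamFlow (fun n : Fin N => freq n) (potential χ N) φ) (T K : ℝ) {D : ℝ} (hD : 0 < D) :
    μ {u | truncTraj φ u T ∉ setA σ p D ∧ potential χ N (lowData N u).1 ≤ K}
      ≤ (1 + ENNReal.ofReal (Real.exp (K / v))) * (C / ENNReal.ofReal (D / 4) ^ (2 * m)) := by
  have hD4 : 0 < D / 4 := by positivity
  set A := {z | toSeq N z ∉ goodSeq σ p (D / 4)}
  have hA : MeasurableSet A := (measurable_toSeq N) (measurableSet_goodSeq σ p (D / 4)).compl
  -- Leaving `A(D)` forces the freely evolved high modes or the Hamiltonian low modes to be bad at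
  -- scale `D / 4`. These give the terms `1` and `exp (K / v)` of the bound.
  have hsub : {u | truncTraj φ u T ∉ setA σ p D ∧ potential χ N (lowData N u).1 ≤ K}
      ⊆ {u | highPart N (coeff (S T u)) ∉ goodSeq σ p (D / 4)} ∪
        {u | φ (lowCoord (normCoeff σ) N u) T ∈ A
          ∧ potential χ N (lowCoord (normCoeff σ) N u).1 ≤ K} := by
    rintro u ⟨hu, hK⟩
    by_contra hnot
    rw [mem_union, not_or] at hnot
    obtain ⟨h1, h2⟩ := hnot
    refine hu (mem_setA_of_goodSeq (by linarith) hD.le (goodSeq_of_parts hp hD (N := N) ?_ ?_))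
    · rw [lowPart_coeff_truncTraj]
      by_contra hlow
      refine h2 ?_
      rw [mem_ofPred_eq, lowCoord_normCoeff]
      exact ⟨hlow, hK⟩
    · rw [highPart_coeff_truncTraj]
      exact not_not.1 h1
  have hhigh : μ {u | highPart N (coeff (S T u)) ∉ goodSeq σ p (D / 4)}
      ≤ C / ENNReal.ofReal (D / 4) ^ (2 * m) := by
    have := hC (fun n => if n < N then 0 else Complex.exp (Complex.I * freq n * T))
      (fun n => by
        split_ifs
        · simp
        · exact (norm_exp_I_freq n T).le) (D / 4) hD4
    refine le_trans (le_of_eq ?_) this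
    congr 1; ext u
    simp only [mem_ofPred_eq]
    have e : highPart N (coeff (S T u)) = fun n =>
        (if n < N then 0 else Complex.exp (Complex.I * freq n * T)) * normCoeff σ n u / freq n := by
      ext n
      rw [mul_div_assoc, normCoeff_div_freq, highPart, coeff_S]
      split_ifs <;> simp
    rw [e]
  have hlow : μ.map (lowCoord (normCoeff σ) N) A ≤ C / ENNReal.ofReal (D / 4) ^ (2 * m) := by
    rw [Measure.map_apply (hg.measurable_lowCoord N) hA]
    have := hC (fun n => if n < N then 1 else 0) (fun n => by split_ifs <;> simp) (D / 4) hD4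
    refine le_trans (le_of_eq ?_) this
    congr 1; ext u
    have e : toSeq N (lowCoord (normCoeff σ) N u) = fun n =>
        (if n < N then 1 else 0) * normCoeff σ n u / freq n := by
      ext n
      rw [mul_div_assoc, normCoeff_div_freq, lowCoord_normCoeff, toSeq_lowData, lowPart]
      split_ifs <;> simp
    simp only [A, mem_preimage, mem_ofPred_eq, e]
  have hmain := hg.measure_hamFlow_mem_le hv contDiff_potential potential_nonneg hφ T K A
  rw [add_mul, one_mul]
  exact (measure_mono hsub).trans ((measure_union_le _ _).trans
    (add_le_add hhigh (hmain.trans (mul_le_mul_right hlow _))))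

end

end

section

open HSob

/-! ### The set `Π` has full measure -/

lemma Dseq_succ_pos {γ₁ : ℝ} (i j : ℕ) : 0 < Dseq γ₁ i (j + 1) := by
  unfold Dseq
  have : (0 : ℝ) < ((j + 1 : ℕ) : ℝ) ^ (1 / γ₁) := Real.rpow_pos_of_pos (by positivity) _
  positivity

lemma exists_tsum_inv_Dseq_le {γ₁ : ℝ} (hγ₁ : 0 < γ₁) :
    ∃ m : ℕ, 3 ≤ m ∧ ∃ C : ℝ≥0∞, C ≠ ⊤ ∧ ∀ i : ℕ, 1 ≤ i →
      ∑' j, (ENNReal.ofReal (Dseq γ₁ i (j + 1) / 4) ^ (2 * m))⁻¹ ≤ C * (i : ℝ≥0∞)⁻¹ := by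
  -- With `l ≥ 2 γ₁`, the power `x ^ l` of `x = (j + 1) ^ (1 / γ₁)` is at least `(j + 1) ^ 2`. Hence
  -- `(i + x) ^ (l + 1) ≥ i (j + 1) ^ 2`: the extra factor gives the decay in `i`, the rest sums
  -- over `j`. The lower bound 2 on `l` ensures `m ≥ 3`.
  set l := max 2 ⌈2 * γ₁⌉₊ with hl
  have hl2 : 2 * γ₁ ≤ l := (Nat.le_ceil _).trans (by exact_mod_cast le_max_right _ _)
  have hl3 : 2 ≤ l := le_max_left _ _
  refine ⟨l + 1, by omega, ∑' j : ℕ, ENNReal.ofReal (16 ^ (l + 1) * (1 / ((j : ℝ) + 1) ^ 2)), ?_,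
    fun i hi => ?_⟩
  · have h := (summable_nat_add_iff 1).2 (Real.summable_one_div_nat_pow.2 one_lt_two)
    have h2 := h.mul_left ((16 : ℝ) ^ (l + 1))
    push_cast at h2
    exact h2.tsum_ofReal_ne_top
  rw [← ENNReal.tsum_mul_right]
  refine ENNReal.tsum_le_tsum fun j => ?_
  have hD := Dseq_succ_pos (γ₁ := γ₁) i j
  set x : ℝ := ((j + 1 : ℕ) : ℝ) ^ (1 / γ₁) with hx
  have hx0 : 0 < x := Real.rpow_pos_of_pos (by positivity) _
  have hi' : (1 : ℝ) ≤ i := by exact_mod_cast hi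
  have hDsq : Dseq γ₁ i (j + 1) ^ 2 = i + x := Real.sq_sqrt (by positivity)
  have hxl : ((j : ℝ) + 1) ^ 2 ≤ x ^ l := by
    have hj : (1 : ℝ) ≤ (j : ℝ) + 1 := by linarith [j.cast_nonneg (α := ℝ)]
    rw [hx, ← Real.rpow_natCast _ l, ← Real.rpow_mul (by positivity), ← Real.rpow_natCast _ 2]
    push_cast
    refine Real.rpow_le_rpow_of_exponent_le hj ?_
    rw [one_div, inv_mul_eq_div, le_div_iff₀ hγ₁]
    exact hl2
  have hlow : i * ((j : ℝ) + 1) ^ 2 / 16 ^ (l + 1) ≤ (Dseq γ₁ i (j + 1) / 4) ^ (2 * (l + 1)) := by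
    rw [pow_mul, div_pow, hDsq, div_pow]
    rw [show ((4 : ℝ) ^ 2) = 16 by norm_num]
    refine div_le_div_of_nonneg_right ?_ (by positivity)
    rw [pow_succ' ((i : ℝ) + x) l]
    have : x ^ l ≤ (i + x) ^ l := pow_le_pow_left₀ hx0.le (by linarith) l
    exact mul_le_mul (by linarith) (hxl.trans this) (by positivity) (by positivity)
  rw [← ENNReal.ofReal_pow (by positivity), ← ENNReal.ofReal_natCast i,
    ← ENNReal.ofReal_inv_of_pos (by positivity), ← ENNReal.ofReal_inv_of_pos (by positivity),
    ← ENNReal.ofReal_mul (by positivity)]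
  refine ENNReal.ofReal_le_ofReal ((inv_anti₀ (by positivity) hlow).trans (le_of_eq ?_))
  field_simp

section

variable {σ : ℝ} {μ : Measure (HSob σ)} [IsProbabilityMeasure μ] {v : ℝ≥0}

/-- A union bound over `j` and both signs of time, after discarding data of potential energy above
`K`. The order of quantifiers matters: `C` does not depend on `K`, and neither constant depends on
`N` or `i`. -/
lemma exists_measure_compl_PiNi_le {χ : ℝ → ℝ} (hχ : IsCutoff χ)
    (hg : IsGaussianSeq μ v (normCoeff σ)) (hv : 0 < v) (hσ' : σ < 1 / 2) {p : ℝ} (hp : 4 < p)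
    (hp' : p < 6) (c c₁ : ℝ) {γ₁ : ℝ} (hγ₁ : 0 < γ₁) :
    ∃ C : ℝ≥0∞, C ≠ ⊤ ∧ ∀ K : ℝ, 0 < K → ∃ B : ℝ≥0∞, B ≠ ⊤ ∧ ∀ N i : ℕ, 1 ≤ N → 1 ≤ i →
      μ (PiNi χ σ p c c₁ γ₁ N i)ᶜ ≤ C / ENNReal.ofReal K ^ (3 / 2 : ℝ) + B * (i : ℝ≥0∞)⁻¹ := by
  obtain ⟨m, hm, C₁, hC₁, hD⟩ := exists_tsum_inv_Dseq_le hγ₁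
  obtain ⟨C₂, hC₂, hgood⟩ := hg.exists_goodSeq_tail hσ' hp hp' hm
  obtain ⟨C, hC, hpot⟩ := hg.exists_potential_tail hχ
  refine ⟨C, hC, fun K hK => ?_⟩
  set e := 1 + ENNReal.ofReal (Real.exp (K / v))
  have he : e ≠ ⊤ := ENNReal.add_ne_top.2 ⟨ENNReal.one_ne_top, ENNReal.ofReal_ne_top⟩
  refine ⟨2 * e * C₂ * C₁, ENNReal.mul_ne_top (ENNReal.mul_ne_top (ENNReal.mul_ne_top
    ENNReal.ofNat_ne_top he) hC₂) hC₁, fun N i hN hi => ?_⟩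
  obtain ⟨φ, hφ⟩ := exists_isHamFlow (ν := fun n : Fin N => freq n) (fun n => freq_pos n)
    (contDiff_potential (χ := χ)) potential_nonneg
  set bad : ℝ → ℕ → Set (HSob σ) := fun T j => {u | truncTraj φ u T ∉ setA σ p (Dseq γ₁ i (j + 1)) ∧
    potential χ N (lowData N u).1 ≤ K}
  set T := Tseq p c c₁ γ₁ i
  have hbad : ∀ t j, μ (bad t j)
      ≤ e * C₂ * (ENNReal.ofReal (Dseq γ₁ i (j + 1) / 4) ^ (2 * m))⁻¹ := fun t j => by
    rw [mul_assoc, ← div_eq_mul_inv]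
    exact measure_truncTraj_notMem_le hg hv (by linarith) hgood hφ t K (Dseq_succ_pos i j)
  have hsub : (PiNi χ σ p c c₁ γ₁ N i)ᶜ ⊆ {u | K < potential χ N (lowCoord (normCoeff σ) N u).1} ∪
      ⋃ j, (bad (T j) j ∪ bad (-T j) j) := by
    intro u hu
    rw [mem_union, mem_iUnion]
    by_cases hKu : K < potential χ N (lowCoord (normCoeff σ) N u).1
    · exact Or.inl hKu
    refine Or.inr ?_
    rw [lowCoord_normCoeff, not_lt] at hKu
    by_contra! hall
    refine hu ⟨truncTraj φ u, isTruncFlow_truncTraj hχ hN hφ u, fun j => ?_⟩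
    have h := hall j
    rw [mem_union, not_or] at h
    exact ⟨by_contra fun h1 => h.1 ⟨h1, hKu⟩, by_contra fun h1 => h.2 ⟨h1, hKu⟩⟩
  refine (measure_mono hsub).trans ((measure_union_le _ _).trans (add_le_add (hpot N K hK) ?_))
  calc μ (⋃ j, (bad (T j) j ∪ bad (-T j) j)) ≤ ∑' j, μ (bad (T j) j ∪ bad (-T j) j) :=
        measure_iUnion_le _
    _ ≤ ∑' j, 2 * e * C₂ * (ENNReal.ofReal (Dseq γ₁ i (j + 1) / 4) ^ (2 * m))⁻¹ := by
        refine ENNReal.tsum_le_tsum fun j => (measure_union_le _ _).trans ?_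
        refine (add_le_add (hbad (T j) j) (hbad (-T j) j)).trans (le_of_eq ?_)
        rw [← two_mul]
        simp only [mul_assoc]
    _ = 2 * e * C₂ * ∑' j, (ENNReal.ofReal (Dseq γ₁ i (j + 1) / 4) ^ (2 * m))⁻¹ :=
        ENNReal.tsum_mul_left
    _ ≤ 2 * e * C₂ * (C₁ * (i : ℝ≥0∞)⁻¹) := mul_le_mul_right (hD i hi) _
    _ = _ := by rw [mul_assoc (2 * e * C₂)]

/-- The set `Π` has full measure for each Gaussian measure `μ` as in the definition of `mu`. -/
lemma measure_compl_PiSet {χ : ℝ → ℝ} (hχ : IsCutoff χ)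
    (hg : IsGaussianSeq μ v (normCoeff σ)) (hv : 0 < v) (hσ' : σ < 1 / 2) {p : ℝ} (hp : 4 < p)
    (hp' : p < 6) (c c₁ : ℝ) {γ₁ : ℝ} (hγ₁ : 0 < γ₁) :
    μ (PiSet χ σ p c c₁ γ₁)ᶜ = 0 := by
  obtain ⟨C, hC, h⟩ := exists_measure_compl_PiNi_le hχ hg hv hσ' hp hp' c c₁ hγ₁
  -- A datum outside `Π` is, for every `i`, outside `Π_{N,i}` for all large `N`; hence `i` may be
  -- taken as large as desired.
  have hi : ∀ i, (PiSet χ σ p c c₁ γ₁)ᶜ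
      ⊆ {u | ∀ᶠ N in atTop, u ∈ (PiNi χ σ p c c₁ γ₁ N i)ᶜ} := fun i u hu => by
    have h1 : u ∉ PiI χ σ p c c₁ γ₁ i := fun hmem => hu (mem_iUnion.2 ⟨i, hmem⟩)
    rw [PiI, mem_limsup_iff_frequently_mem, not_frequently] at h1
    exact h1
  have hK : ∀ K : ℝ, 0 < K →
      μ (PiSet χ σ p c c₁ γ₁)ᶜ ≤ C / ENNReal.ofReal K ^ (3 / 2 : ℝ) := fun K hK0 => by
    obtain ⟨B, hB, hBi⟩ := h K hK0
    have hlim : Tendsto (fun i : ℕ => C / ENNReal.ofReal K ^ (3 / 2 : ℝ) + B * (i : ℝ≥0∞)⁻¹) atTop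
        (nhds (C / ENNReal.ofReal K ^ (3 / 2 : ℝ) + B * 0)) :=
      tendsto_const_nhds.add
        (ENNReal.Tendsto.const_mul ENNReal.tendsto_inv_nat_nhds_zero (Or.inr hB))
    rw [mul_zero, add_zero] at hlim
    refine ge_of_tendsto hlim ?_
    filter_upwards [eventually_ge_atTop 1] with i hi1
    refine (measure_mono (hi i)).trans (measure_eventually_mem_le ?_)
    filter_upwards [eventually_ge_atTop 1] with N hN using hBi N i hN hi1
  have hlim : Tendsto (fun k : ℕ => C / (k : ℝ≥0∞) ^ (3 / 2 : ℝ)) atTop (nhds 0) := by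
    have h1 : Tendsto (fun k : ℕ => (k : ℝ≥0∞) ^ (3 / 2 : ℝ)) atTop (nhds ⊤) := by
      have := ((ENNReal.continuous_rpow_const (y := (3 / 2 : ℝ))).tendsto ⊤).comp
        ENNReal.tendsto_nat_nhds_top
      rwa [ENNReal.top_rpow_of_pos (by norm_num)] at this
    simpa using ENNReal.Tendsto.const_div h1 (Or.inr hC)
  refine le_antisymm (ge_of_tendsto hlim ?_) zero_le
  filter_upwards [eventually_ge_atTop 1] with k hk
  have := hK k (by exact_mod_cast hk)
  rwa [ENNReal.ofReal_natCast] at this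

end

/-! ### The law of the random series -/

section

variable {σ : ℝ}

lemma isometry_weighted : Isometry (weighted : HSob σ → lp (fun _ : ℕ => ℂ) 2) :=
  AddMonoidHomClass.isometry_of_norm weighted fun _ => rfl

lemma continuous_coeff (n : ℕ) : Continuous fun u : HSob σ => coeff u n := by
  have h1 : Continuous fun u : HSob σ => (weighted u : ℕ → ℂ) n :=
    (lp.lipschitzWith_one_eval 2 n).continuous.comp isometry_weighted.continuous
  have h2 : ((freq n ^ σ : ℝ) : ℂ) ≠ 0 :=
    Complex.ofReal_ne_zero.2 (Real.rpow_pos_of_pos (freq_pos n) σ).ne'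
  have e : (fun u : HSob σ => coeff u n)
      = fun u => (((freq n ^ σ : ℝ) : ℂ))⁻¹ * (weighted u : ℕ → ℂ) n := by
    ext u
    exact (inv_mul_cancel_left₀ h2 _).symm
  rw [e]
  exact continuous_const.mul h1

lemma mem_sobolevSeq_iff {c : ℕ → ℂ} : c ∈ sobolevSeq σ ↔ sobolevSq σ c ≠ ⊤ := by
  change Memℓp (fun n => ((freq n ^ σ : ℝ) : ℂ) * c n) 2 ↔ _
  rw [memℓp_gen_iff (by norm_num)]
  have e : sobolevSq σ c
      = ∑' n, ((‖((freq n ^ σ : ℝ) : ℂ) * c n‖₊ ^ (2 : ℝ) : ℝ≥0) : ℝ≥0∞) := by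
    refine tsum_congr fun n => ?_
    rw [ENNReal.coe_rpow_of_nonneg _ two_pos.le, enorm_eq_nnnorm]
  rw [e, ENNReal.tsum_coe_ne_top_iff_summable, ← NNReal.summable_coe]
  simp

lemma tendsto_finElt (u : HSob σ) :
    Tendsto (fun M => finElt σ M (coeff u)) atTop (nhds u) := by
  rw [isometry_weighted.isEmbedding.tendsto_nhds_iff]
  have h := (lp.hasSum_single (p := 2) (by norm_num) (weighted u)).tendsto_sum_nat
  refine h.congr fun M => ?_
  ext n
  change _ = ((freq n ^ σ : ℝ) : ℂ) * lowPart M (coeff u) n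
  rw [lp.coeFn_sum, Finset.sum_apply]
  simp only [lp.single_apply, Pi.single_apply, lowPart]
  rw [Finset.sum_ite_eq (Finset.range M) n]
  simp only [Finset.mem_range, mul_ite, mul_zero]
  rfl

/-- `finElt` as a linear map on finite sequences. -/
def finEltLinear (σ : ℝ) (M : ℕ) : (Fin M → ℂ) →ₗ[ℂ] HSob σ where
  toFun c := finElt σ M fun n => if h : n < M then c ⟨n, h⟩ else 0
  map_add' a b := coeff_ext fun n => by
    rw [map_add, Pi.add_apply, coeff_finElt, coeff_finElt, coeff_finElt]
    simp only [lowPart]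
    split_ifs <;> simp
  map_smul' k a := coeff_ext fun n => by
    rw [map_smul, Pi.smul_apply, coeff_finElt, coeff_finElt]
    simp only [lowPart]
    split_ifs <;> simp

lemma measurable_finElt (M : ℕ) : Measurable (finElt σ M) := by
  have h : finElt σ M = finEltLinear σ M ∘ fun c (n : Fin M) => c n := by
    ext c : 1
    refine coeff_ext fun n => ?_
    change _ = coeff (finElt σ M fun n => if n < M then c n else 0) n
    rw [coeff_finElt, coeff_finElt]
    simp only [lowPart]
    split_ifs <;> rfl
  rw [h]
  exact (finEltLinear σ M).continuous_of_finiteDimensional.measurable.comp (by fun_prop)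

lemma randomSeries_of_mem {Ω : Type*} {g : ℕ → Ω → ℂ} {w : Ω} (h : (fun n => g n w / freq n) ∈ sobolevSeq σ) :
    randomSeries σ g w = (⟨_, h⟩ : HSob σ) :=
  dif_pos h

lemma randomSeries_of_notMem {Ω : Type*} {g : ℕ → Ω → ℂ} {w : Ω} (h : (fun n => g n w / freq n) ∉ sobolevSeq σ) :
    randomSeries σ g w = 0 :=
  dif_neg h

variable {Ω : Type*} [MeasurableSpace Ω] {P : Measure Ω} {v : ℝ≥0} {g : ℕ → Ω → ℂ}

/-- The random series is a pointwise limit, in the norm of `H^σ`, of its finite partial sums, which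
are measurable because linear maps from finite-dimensional spaces are continuous. -/
lemma measurable_randomSeries (hg : ∀ n, Measurable (g n)) : Measurable (randomSeries σ g) := by
  classical
  have hset : MeasurableSet {w | (fun n => g n w / freq n) ∈ sobolevSeq σ} := by
    simp only [mem_sobolevSeq_iff]
    exact ((measurable_sobolevSq σ).comp (by fun_prop)) (measurableSet_singleton ⊤).compl
  refine measurable_of_tendsto_metrizable (f := fun M w =>
    if (fun n => g n w / freq n) ∈ sobolevSeq σ then finElt σ M (fun n => g n w / freq n) else 0)
    (fun M => Measurable.ite hset ((measurable_finElt M).comp (by fun_prop)) measurable_const)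
    (tendsto_pi_nhds.2 fun w => ?_)
  by_cases h : (fun n => g n w / freq n) ∈ sobolevSeq σ
  · rw [randomSeries_of_mem h]
    simp only [h, if_true]
    exact tendsto_finElt (⟨_, h⟩ : HSob σ)
  · rw [randomSeries_of_notMem h]
    simp only [h, if_false]
    exact tendsto_const_nhds

lemma IsGaussianSeq.ae_mem_sobolevSeq [IsProbabilityMeasure P] (hg : IsGaussianSeq P v g)
    (hσ' : σ < 1 / 2) : ∀ᵐ w ∂P, (fun n => g n w / freq n) ∈ sobolevSeq σ := by
  obtain ⟨C, hC, hD⟩ := hg.exists_sobolevSq_tail hσ' one_lt_two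
  -- Where the series diverges, `sobolevSq` is infinite and exceeds every level `k²`.
  have hk : ∀ k : ℕ, 1 ≤ k → P {w | (fun n => g n w / freq n) ∉ sobolevSeq σ}
      ≤ C / (k : ℝ≥0∞) ^ (2 * 2) := fun k hk => by
    have h := hD (fun _ => 1) (fun _ => by simp) k (by exact_mod_cast hk)
    rw [ENNReal.ofReal_natCast] at h
    refine (measure_mono fun w hw => ?_).trans h
    rw [mem_ofPred_eq, mem_sobolevSeq_iff, not_not] at hw
    simp only [one_mul, mem_ofPred_eq, hw]
    exact ENNReal.ofReal_lt_top
  have hlim : Tendsto (fun k : ℕ => C / (k : ℝ≥0∞) ^ (2 * 2)) atTop (nhds 0) := by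
    have h1 : Tendsto (fun k : ℕ => (k : ℝ≥0∞) ^ (2 * 2)) atTop (nhds ⊤) := by
      have := ((ENNReal.continuous_pow (2 * 2)).tendsto ⊤).comp ENNReal.tendsto_nat_nhds_top
      rwa [ENNReal.top_pow (by norm_num)] at this
    simpa using ENNReal.Tendsto.const_div h1 (Or.inr hC)
  rw [ae_iff]
  exact le_antisymm (ge_of_tendsto hlim ((eventually_ge_atTop 1).mono hk)) zero_le

/-- Transfers the problem to the probability space `(H^σ, μ)` itself: the normalised coefficients
are there a Gaussian sequence of the same kind, since almost surely the series converges and has the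
prescribed coefficients. -/
lemma IsGaussianSeq.mu [IsProbabilityMeasure P] (hg : IsGaussianSeq P v g) (hσ' : σ < 1 / 2) :
    IsGaussianSeq (mu P σ g) v (normCoeff σ) := by
  have hU := measurable_randomSeries (σ := σ) hg.meas
  have hmeas : ∀ n, Measurable (normCoeff σ n) := fun n =>
    (continuous_const.mul (continuous_coeff n)).measurable
  have hae : ∀ n, normCoeff σ n ∘ randomSeries σ g =ᵐ[P] g n := fun n => by
    filter_upwards [hg.ae_mem_sobolevSeq hσ'] with w hw
    have e : coeff (randomSeries σ g w) n = g n w / freq n := by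
      rw [randomSeries_of_mem hw]
      rfl
    rw [Function.comp_apply, normCoeff, e,
      mul_div_cancel₀ _ (Complex.ofReal_ne_zero.2 (freq_pos n).ne')]
  refine ⟨hmeas, fun n => ?_, ?_⟩
  · rw [RadialWave.mu, Measure.map_map (hmeas n) hU, Measure.map_congr (hae n), hg.law]
  · have hind : iIndepFun (fun n => normCoeff σ n ∘ randomSeries σ g) P :=
      hg.indep.congr fun n => (hae n).symm
    rw [iIndepFun_iff_measure_inter_preimage_eq_mul] at hind ⊢
    intro S s hs
    have h1 : ∀ n ∈ S, MeasurableSet (normCoeff σ n ⁻¹' s n) := fun n hn => hmeas n (hs n hn)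
    rw [RadialWave.mu, Measure.map_apply hU (Finset.measurableSet_biInter S h1), preimage_iInter₂]
    simp only [← preimage_comp]
    rw [hind S hs]
    refine Finset.prod_congr rfl fun n hn => ?_
    rw [Measure.map_apply hU (h1 n hn), preimage_comp]

end

end

end RadialWave

end

theorem mainTheorem6 {Ω : Type*} [MeasurableSpace Ω] (P : Measure Ω) [IsProbabilityMeasure P]
    (σ p : ℝ) (hσ : 0 < σ) (hσ' : σ < 1 / 2) (hp : 4 < p) (hp' : p < 6)
    (χ : ℝ → ℝ) (hχ : RadialWave.IsCutoff χ)
    (v : ℝ≥0) (hv : 0 < v) (g : ℕ → Ω → ℂ) (hg : ∀ n, Measurable (g n))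
    (hlaw : ∀ n, P.map (g n) = RadialWave.complexGaussian v) (hindep : iIndepFun g P)
    (c c₁ γ₁ : ℝ) (hc : 0 < c) (hc₁ : 0 < c₁) (hγ₁ : 0 < γ₁) :
    RadialWave.rho P σ g (RadialWave.PiSet χ σ p c c₁ γ₁)ᶜ = 0 := by
  have hgauss : RadialWave.IsGaussianSeq P v g := ⟨hg, hlaw, hindep⟩
  have : IsProbabilityMeasure (RadialWave.mu P σ g) :=
    Measure.isProbabilityMeasure_map (RadialWave.measurable_randomSeries hg).aemeasurable
  -- A `μ`-null set is null for any measure with a density with respect to `μ`.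
  exact withDensity_absolutelyContinuous _ _
    (RadialWave.measure_compl_PiSet hχ (hgauss.mu hσ') hv hσ' hp hp' c c₁ hγ₁)
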